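/- Let $n\ge 3$. There is a function $C$ (depending only on $n$), assigning a real number $C(\varphi)$ to each function $\varphi:\mathbb R\to\mathbb R$, such that the following holds. Let $Y=(Y^0,Y^1)=(u_0,v_0)$ be a measurable random function on a probability space $(\Omega,\Sigma,P)$ with values in the phase space $H^1_{\rm loc}(\mathbb R^n)\oplus L^2_{\rm loc}(\mathbb R^n)$ of pairs of real functions; in particular $(\omega,x)\mapsto Y(\omega,x)$ is measurable with respect to the completed product $\sigma$-algebra. Assume: - (zero mean) $E\,Y(x)=0$ for almost all $x\in\mathbb R^n$; - (translation-invariant covariance) there are functions $q_0^{ij}:\mathbb R^n\to\mathbb R$, $i,j\in\{0,1\}$, with $E\big(Y^i(x)Y^j(y)\big)=q_0^{ij}(x-y)$ for almost all $(x,y)\in\mathbb R^n\times\mathbb R^n$; - (finite mean energy density) there is $e_0\in[0,\infty)$ with $E\big(|v_0(x)|^2+|\nabla u_0(x)|^2+|u_0(x)|^2\big)=e_0$ for almost all $x$, where $\nabla u_0$ is the weak gradient; - (mixing) the Ibragimov–Linnik mixing coefficient $$\varphi(r)=\sup_{\mathcal A,\mathcal B}\ \sup_{A\in\sigma(\mathcal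 A),\,B\in\sigma(\mathcal B),\,P(B)>0}\frac{|P(A\cap B)-P(A)P(B)|}{P(B)}$$ satisfies $\varphi(r)\to0$ as $r\to\infty$ and $\int_0^\infty r^{n-2}\varphi^{1/2}(r)\,dr<\infty$. Here $\mathcal A,\mathcal B$ run over the open subsets of $\mathbb R^n$ at distance at least $r$ from each other, and $\sigma(\mathcal A)$ is the $\sigma$-algebra generated by the random variables $\langle Y,\Psi\rangle=\int (Y^0\Psi^0+Y^1\Psi^1)\,dx$ with $\Psi^0,\Psi^1\in C_0^\infty(\mathbb R^n)$ real and supported in $\mathcal A$. Then for all $i,j\in\{0,1\}$ the function $q_0^{ij}$ defines a tempered distribution, and its Fourier transform in the sense of tempered distributions (normalized by $F\psi(k)=\int e^{ik\cdot x}\psi(x)\,dx$ for Schwartz functions $\psi$) is a function $\hat q_0^{ij}$ that belongs to $L^p(\mathbb R^n)$ for every $1\le p\le 2$ and satisfies $$\int_{\mathbb R^n}\big(|k|^{2-i-j}+|k|^{-2}\big)\,|\hat q_0^{ij}(k)|\,dk\le C(\varphi)\,e_0<\infty .$$ -/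

import Mathlib

open MeasureTheory Filter Topology
open scoped ENNReal NNReal SchwartzMap

noncomputable section

namespace WaveCov

/-- Euclidean space `ℝⁿ`. -/
abbrev E (n : ℕ) : Type := EuclideanSpace ℝ (Fin n)

variable {n : ℕ}

/-- Real test functions: the elements of `C₀^∞(ℝⁿ)`. -/
def IsTest (ψ : E n → ℝ) : Prop :=
  ContDiff ℝ ((⊤ : ℕ∞) : WithTop ℕ∞) ψ ∧ HasCompactSupport ψ

/-- `f ∈ L²_loc(ℝⁿ)`: `f` is square integrable on every ball. -/
def MemL2Loc {F : Type*} [NormedAddCommGroup F] (f : E n → F) : Prop :=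
  ∀ R : ℝ, MemLp f 2 (volume.restrict (Metric.ball 0 R))

/-- `g` is the weak (distributional) gradient of the locally integrable function `u`. -/
def IsWeakGradient (u : E n → ℝ) (g : E n → E n) : Prop :=
  LocallyIntegrable u volume ∧ LocallyIntegrable g volume ∧
    ∀ ψ : E n → ℝ, IsTest ψ → ∀ w : E n,
      ∫ x, u x * fderiv ℝ ψ x w = - ∫ x, inner ℝ (g x) w * ψ x

/-- The phase space `H¹_loc(ℝⁿ) ⊕ L²_loc(ℝⁿ)` of states of finite local energy;
a state is a pair `y = (y 0, y 1) = (u, v)`. -/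
def MemPhaseSpace (y : Fin 2 → E n → ℝ) : Prop :=
  MemL2Loc (y 0) ∧ (∃ g : E n → E n, IsWeakGradient (y 0) g ∧ MemL2Loc g) ∧ MemL2Loc (y 1)

/-- The pairing `⟨y, Ψ⟩ = ∫ y⁰ Ψ⁰ dx + ∫ y¹ Ψ¹ dx`. -/
def pairing (y Ψ : Fin 2 → E n → ℝ) : ℝ :=
  ∑ i : Fin 2, ∫ x, y i x * Ψ i x

variable {Ω : Type*} [MeasurableSpace Ω]

/-- `Y = (Y 0, Y 1) = (u₀, v₀)` is a measurable random function on the probability space `(Ω, P)`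
with values in the phase space. Its realizations lie in the phase space, it is measurable as a
random element (the Borel `σ`-algebra of the separable Fréchet space `H¹_loc ⊕ L²_loc` is generated
by the pairings with test functions), and `(ω, x) ↦ Y(ω, x)` is measurable with respect to the
completed product `σ`-algebra. -/
structure IsRandomState (P : Measure Ω) (Y : Fin 2 → Ω → E n → ℝ) : Prop where
  mem : ∀ ω, MemPhaseSpace (fun i => Y i ω)
  measurable_pairing : ∀ Ψ : Fin 2 → E n → ℝ, (∀ i, IsTest (Ψ i)) →
    Measurable (fun ω => pairing (fun i => Y i ω) Ψ)
  aemeasurable : ∀ i, AEMeasurable (fun z : Ω × E n => Y i z.1 z.2) (P.prod volume)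

/-- Zero expectation: `E Y(x) = 0` for almost all `x`. -/
def ZeroMean (P : Measure Ω) (Y : Fin 2 → Ω → E n → ℝ) : Prop :=
  ∀ i, ∀ᵐ x : E n, ∫ ω, Y i ω x ∂P = 0

/-- The covariance functions are translation invariant: `E (Yⁱ(x) Yʲ(y)) = qⁱʲ(x - y)` for almost
all `(x, y)`. (This determines each `qⁱʲ` up to a null set.) -/
def HasCovariance (P : Measure Ω) (Y : Fin 2 → Ω → E n → ℝ) (q : Fin 2 → Fin 2 → E n → ℝ) : Prop :=
  ∀ i j, ∀ᵐ z : E n × E n, ∫ ω, Y i ω z.1 * Y j ω z.2 ∂P = q i j (z.1 - z.2)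

/-- The mean energy density `E (|v₀(x)|² + |∇u₀(x)|² + |u₀(x)|²)` is finite and equal to `e₀` for
almost all `x`. Here `G` is a jointly measurable version of `(ω, x) ↦ ∇u₀(ω, x)`; two such
versions agree almost everywhere on `Ω × ℝⁿ`, so the choice is immaterial. -/
def HasMeanEnergyDensity (P : Measure Ω) (Y : Fin 2 → Ω → E n → ℝ) (e₀ : ℝ≥0) : Prop :=
  ∃ G : Ω → E n → E n,
    AEMeasurable (fun z : Ω × E n => G z.1 z.2) (P.prod volume) ∧
    (∀ᵐ ω ∂P, IsWeakGradient (Y 0 ω) (G ω)) ∧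
    ∀ᵐ x : E n, ∫⁻ ω, (‖Y 1 ω x‖ₑ ^ 2 + ‖G ω x‖ₑ ^ 2 + ‖Y 0 ω x‖ₑ ^ 2) ∂P = (e₀ : ℝ≥0∞)

/-- The `σ`-algebra `σ(A)` generated by the functionals `⟨Y, Ψ⟩`, where `Ψ` is a pair of test
functions with support in `A` (pulled back from the phase space to `Ω` along `Y`). -/
@[reducible] def sigmaAlg (Y : Fin 2 → Ω → E n → ℝ) (A : Set (E n)) : MeasurableSpace Ω :=
  ⨆ (Ψ : Fin 2 → E n → ℝ) (_ : ∀ i, IsTest (Ψ i) ∧ tsupport (Ψ i) ⊆ A),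
    MeasurableSpace.comap (fun ω => pairing (fun i => Y i ω) Ψ) (borel ℝ)

/-- The Ibragimov–Linnik mixing coefficient `φ(r)` of the distribution of `Y`: the supremum of
`|P(S ∩ T) - P(S) P(T)| / P(T)` over `S ∈ σ(A)`, `T ∈ σ(B)` with `P(T) > 0` and open sets `A`, `B`
at distance at least `r`. (All these quotients lie in `[0, 1]`.) -/
def mixingCoeff (P : Measure Ω) (Y : Fin 2 → Ω → E n → ℝ) (r : ℝ) : ℝ :=
  sSup {c : ℝ | ∃ A B : Set (E n), IsOpen A ∧ IsOpen B ∧ (∀ x ∈ A, ∀ y ∈ B, r ≤ dist x y) ∧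
    ∃ S T : Set Ω, MeasurableSet[sigmaAlg Y A] S ∧ MeasurableSet[sigmaAlg Y B] T ∧
      0 < P.real T ∧ c = |P.real (S ∩ T) - P.real S * P.real T| / P.real T}

/-- The strong uniform mixing condition `φ(r) → 0`, with the rate
`∫₀^∞ r^{n-2} φ(r)^{1/2} dr < ∞`. (Used for `n ≥ 3` only.) -/
def IsMixing (P : Measure Ω) (Y : Fin 2 → Ω → E n → ℝ) : Prop :=
  Tendsto (mixingCoeff P Y) atTop (𝓝 0) ∧
    IntegrableOn (fun r : ℝ => r ^ (n - 2) * √(mixingCoeff P Y r)) (Set.Ioi 0)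

/-- `(Fψ)(k) = ∫ e^{i k·x} ψ(x) dx`. -/
def fourier (ψ : E n → ℂ) (k : E n) : ℂ :=
  ∫ x, Complex.exp (Complex.I * ((inner ℝ k x : ℝ) : ℂ)) * ψ x

/-- The function `g` is the Fourier transform of the function `q` in the sense of tempered
distributions: both functions define tempered distributions, and `⟨g, ψ⟩ = ⟨q, Fψ⟩` for every
Schwartz function `ψ`. -/
def IsTemperedFourier (q : E n → ℝ) (g : E n → ℂ) : Prop :=
  (∀ ψ : 𝓢(E n, ℂ), Integrable (fun x => (q x : ℂ) * ψ x)) ∧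
  (∀ ψ : 𝓢(E n, ℂ), Integrable (fun k => g k * ψ k)) ∧
  ∀ ψ : 𝓢(E n, ℂ), ∫ k, g k * ψ k = ∫ x, (q x : ℂ) * fourier ψ x

end WaveCov

end

noncomputable section

namespace WaveCov

/-! Mixing gives decay of the covariance, and positivity of the spectral matrix turns this decay
into an integral bound near `k = 0`.

Decay: the Ibragimov–Linnik inequality (`covariance_le_of_mixing`), applied to the field smeared
near two points and passed to the limit of shrinking mollifiers, yields `|q(x)| ≤ 2 e₀ √φ(|x|/2)`
almost everywhere (`ae_abs_cov_le_mixing`). As `φ` is nonincreasing, the rate condition bounds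
`r^(n-1) √φ(r)`, so `φ(|x|/2)` is integrable and `q ∈ L²`. Also `|x|^(2-n) √φ(|x|/2)` is integrable,
since polar coordinates leave the weight `r ≤ 1 + r^(n-2)`.

Positivity: let `f i j ∈ L²` be the transform of `q i j`. Quadratic forms of the smeared field are
second moments, so the matrix `f i j k` is almost everywhere positive semidefinite
(`ae_spectral_nonneg`). Off-diagonal entries are then dominated by the diagonal, with weights `2 w
|f₀₁| ≤ w² |f₀₀| + |f₁₁|`; for `w` proportional to `|k|` this matches the powers `|k|^(2-i-j)`.

Moments of the diagonal: testing with mollifiers and Fatou's lemma give `∫ f i i ≤ e₀`, and the weak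
gradient gives the second moment of `f 0 0`. For the inverse moment, `|k|⁻²` is bounded by a
superposition over scales `s` of cutoffs `χ(s k)`; on the side of `q` the same superposition of
kernels is bounded by the Riesz kernel `|x|^(2-n)` (`exists_lintegral_inv_sq_spectral_le`).

The exponent `+i k·x` without `2π` is Mathlib's inverse transform up to dilation, so the work is
done with `𝓕⁻` and rescaled by `2π` at the end. -/

theorem exists_finite_approx {Ω : Type*} [MeasurableSpace Ω] {f : Ω → ℝ} (hf : Measurable f) :
    ∃ F : ℕ → Ω → ℝ, (∀ k, Measurable (F k)) ∧ (∀ k, ∃ s : Finset ℝ, ∀ ω, F k ω ∈ s) ∧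
      (∀ k ω, ‖F k ω‖ ≤ 2 * ‖f ω‖) ∧ ∀ ω, Tendsto (fun k => F k ω) atTop (𝓝 (f ω)) := by
  refine ⟨fun k => SimpleFunc.approxOn f hf Set.univ 0 (Set.mem_univ _) k,
    fun k => SimpleFunc.measurable _, fun k => ⟨SimpleFunc.range _,
      fun ω => SimpleFunc.mem_range_self _ ω⟩, fun k ω => ?_, fun ω => ?_⟩
  · rw [two_mul]
    exact SimpleFunc.norm_approxOn_zero_le hf (Set.mem_univ _) ω k
  · exact SimpleFunc.tendsto_approxOn hf _ (by simp)

/-! ### The covariance inequality for two mixing `σ`-algebras. -/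

section Mixing

variable {Ω : Type*} {m₁ m₂ : MeasurableSpace Ω} [m₀ : MeasurableSpace Ω] {P : Measure Ω}

theorem integral_comp_of_finite (h₁ : m₁ ≤ m₀) [IsFiniteMeasure P]
    {f : Ω → ℝ} (hf : Measurable[m₁] f) {s : Finset ℝ} (hs : ∀ ω, f ω ∈ s) (h : ℝ → ℝ) :
    ∫ ω, h (f ω) ∂P = ∑ a ∈ s, P.real (f ⁻¹' {a}) * h a := by
  have hS : ∀ a, MeasurableSet (f ⁻¹' {a}) := fun a => h₁ _ (hf (measurableSet_singleton a))
  have : (fun ω => h (f ω)) = fun ω => ∑ a ∈ s, (f ⁻¹' {a}).indicator (fun _ => h a) ω := by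
    funext ω
    rw [Finset.sum_eq_single (f ω)]
    · simp
    · intro b _ hb
      rw [Set.indicator_of_notMem]
      simpa using hb.symm
    · exact fun h => absurd (hs ω) h
  rw [this, integral_finsetSum]
  · refine Finset.sum_congr rfl fun a _ => ?_
    rw [integral_indicator (hS a), setIntegral_const, smul_eq_mul]
  · intro a _
    exact (integrable_const _).indicator (hS a)

theorem integral_comp_of_finite₂ (h₁ : m₁ ≤ m₀) (h₂ : m₂ ≤ m₀) [IsFiniteMeasure P]
    {f : Ω → ℝ} (hf : Measurable[m₁] f) {s : Finset ℝ} (hs : ∀ ω, f ω ∈ s) {g : Ω → ℝ} (hg : Measurable[m₂] g) {t : Finset ℝ} (ht : ∀ ω, g ω ∈ t) (h : ℝ → ℝ → ℝ) :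
    ∫ ω, h (f ω) (g ω) ∂P =
      ∑ p ∈ s ×ˢ t, P.real (f ⁻¹' {p.1} ∩ g ⁻¹' {p.2}) * h p.1 p.2 := by
  have hS : ∀ p : ℝ × ℝ, MeasurableSet (f ⁻¹' {p.1} ∩ g ⁻¹' {p.2}) := fun p =>
    (h₁ _ (hf (measurableSet_singleton p.1))).inter (h₂ _ (hg (measurableSet_singleton p.2)))
  have : (fun ω => h (f ω) (g ω)) = fun ω => ∑ p ∈ s ×ˢ t,
      (f ⁻¹' {p.1} ∩ g ⁻¹' {p.2}).indicator (fun _ => h p.1 p.2) ω := by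
    funext ω
    rw [Finset.sum_eq_single (f ω, g ω)]
    · simp
    · rintro ⟨a, b⟩ _ hb
      rw [Set.indicator_of_notMem]
      simp only [Set.mem_inter_iff, Set.mem_preimage, Set.mem_singleton_iff]
      rintro ⟨rfl, rfl⟩
      exact hb rfl
    · exact fun h => absurd (Finset.mem_product.2 ⟨hs ω, ht ω⟩) h
  rw [this, integral_finsetSum]
  · refine Finset.sum_congr rfl fun a _ => ?_
    rw [integral_indicator (hS a), setIntegral_const, smul_eq_mul]
  · intro a _
    exact (integrable_const _).indicator (hS a)

/-- If all deviations `|P(S ∩ T) - P(S) P(T)|` are at most `φ P(T)`, then so is the sum of the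
deviations over a finite measurable partition, up to a factor `2`. -/
theorem sum_abs_deviation_le (h₁ : m₁ ≤ m₀) [IsProbabilityMeasure P] {φ : ℝ}
    {f : Ω → ℝ} (hf : Measurable[m₁] f) (s : Finset ℝ) {T : Set Ω}
    (h : ∀ S, MeasurableSet[m₁] S → |P.real (S ∩ T) - P.real S * P.real T| ≤ φ * P.real T) :
    ∑ a ∈ s, |P.real (f ⁻¹' {a} ∩ T) - P.real (f ⁻¹' {a}) * P.real T|
      ≤ 2 * φ * P.real T := by
  set D : ℝ → ℝ := fun a => P.real (f ⁻¹' {a} ∩ T) - P.real (f ⁻¹' {a}) * P.real T with hD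
  -- A union of level sets is again in `m₁`, so a signed sum of deviations is a single deviation.
  -- Splitting by sign then costs the factor `2`.
  have key : ∀ s : Finset ℝ, |∑ a ∈ s, D a| ≤ φ * P.real T := by
    intro s
    have hS : ∀ a ∈ s, MeasurableSet (f ⁻¹' {a}) := fun a _ => h₁ _ (hf (measurableSet_singleton a))
    have hm : MeasurableSet[m₁] (f ⁻¹' (s : Set ℝ)) := hf s.measurableSet
    convert h _ hm using 2
    have e := sum_measureReal_preimage_singleton (μ := P.restrict T) s hS
    rw [measureReal_restrict_apply (h₁ _ hm)] at e
    rw [← e, ← sum_measureReal_preimage_singleton s hS, Finset.sum_mul, ← Finset.sum_sub_distrib]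
    refine Finset.sum_congr rfl fun a ha => ?_
    rw [measureReal_restrict_apply (hS a ha)]
  have hsplit : ∑ a ∈ s, |D a| =
      ∑ a ∈ s with 0 ≤ D a, D a + -∑ a ∈ s with ¬ 0 ≤ D a, D a := by
    rw [← Finset.sum_filter_add_sum_filter_not s (fun a => 0 ≤ D a), ← Finset.sum_neg_distrib]
    congr 1
    · exact Finset.sum_congr rfl fun a ha => abs_of_nonneg (Finset.mem_filter.1 ha).2
    · exact Finset.sum_congr rfl fun a ha => abs_of_neg (not_le.1 (Finset.mem_filter.1 ha).2)
  rw [hsplit]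
  have k1 := le_abs_self (∑ a ∈ s with 0 ≤ D a, D a)
  have k2 := neg_le_abs (∑ a ∈ s with ¬ 0 ≤ D a, D a)
  linarith [key {a ∈ s | 0 ≤ D a}, key {a ∈ s | ¬ 0 ≤ D a}]

/-- Cauchy–Schwarz with the weights `|D|` on pairs of values. The mixing condition is relative to
`P(T)` only, so the sum of `|D| b²` gains the factor `φ`, whereas the sum of `|D| a²` gets the
trivial bound; hence a square root of `φ` in the covariance. -/
theorem covariance_of_finite_le (h₁ : m₁ ≤ m₀) (h₂ : m₂ ≤ m₀) [IsProbabilityMeasure P] {φ : ℝ}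
    (h : ∀ S T, MeasurableSet[m₁] S → MeasurableSet[m₂] T →
      |P.real (S ∩ T) - P.real S * P.real T| ≤ φ * P.real T)
    {f : Ω → ℝ} (hf : Measurable[m₁] f) {s : Finset ℝ} (hs : ∀ ω, f ω ∈ s) {g : Ω → ℝ} (hg : Measurable[m₂] g) {t : Finset ℝ} (ht : ∀ ω, g ω ∈ t) :
    (∫ ω, f ω * g ω ∂P - (∫ ω, f ω ∂P) * ∫ ω, g ω ∂P) ^ 2
      ≤ 4 * φ * (∫ ω, f ω ^ 2 ∂P) * ∫ ω, g ω ^ 2 ∂P := by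
  set D : ℝ × ℝ → ℝ := fun p => P.real (f ⁻¹' {p.1} ∩ g ⁻¹' {p.2})
    - P.real (f ⁻¹' {p.1}) * P.real (g ⁻¹' {p.2}) with hD
  have hcov : ∫ ω, f ω * g ω ∂P - (∫ ω, f ω ∂P) * ∫ ω, g ω ∂P
      = ∑ p ∈ s ×ˢ t, D p * (p.1 * p.2) := by
    rw [integral_comp_of_finite₂ h₁ h₂ hf hs hg ht (fun a b => a * b),
      integral_comp_of_finite h₁ hf hs (fun a => a), integral_comp_of_finite h₂ hg ht (fun a => a),
      Finset.sum_mul_sum, ← Finset.sum_product', ← Finset.sum_sub_distrib]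
    refine Finset.sum_congr rfl fun p _ => ?_
    simp only [hD]; ring
  have hφ : ∀ p : ℝ × ℝ, |D p| ≤ P.real (f ⁻¹' {p.1} ∩ g ⁻¹' {p.2})
      + P.real (f ⁻¹' {p.1}) * P.real (g ⁻¹' {p.2}) := by
    intro p
    refine (abs_sub _ _).trans (le_of_eq ?_)
    rw [abs_of_nonneg measureReal_nonneg,
      abs_of_nonneg (mul_nonneg measureReal_nonneg measureReal_nonneg)]
  have hF : ∑ p ∈ s ×ˢ t, |D p| * p.1 ^ 2 ≤ 2 * ∫ ω, f ω ^ 2 ∂P := by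
    have e1 := integral_comp_of_finite₂ (P := P) h₁ h₂ hf hs hg ht (fun a _ => a ^ 2)
    have e2 := integral_comp_of_finite (P := P) h₁ hf hs (fun a => a ^ 2)
    have e3 := integral_comp_of_finite (P := P) h₂ hg ht (fun _ => 1)
    simp only [integral_const, probReal_univ, smul_eq_mul, mul_one] at e3
    have e4 : ∑ p ∈ s ×ˢ t,
        P.real (f ⁻¹' {p.1}) * P.real (g ⁻¹' {p.2}) * p.1 ^ 2 = ∫ ω, f ω ^ 2 ∂P := by
      rw [e2, ← mul_one (∑ a ∈ s, _), e3, Finset.sum_mul_sum, ← Finset.sum_product']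
      refine Finset.sum_congr rfl fun p _ => ?_
      ring
    calc _ ≤ ∑ p ∈ s ×ˢ t, (P.real (f ⁻¹' {p.1} ∩ g ⁻¹' {p.2})
          + P.real (f ⁻¹' {p.1}) * P.real (g ⁻¹' {p.2})) * p.1 ^ 2 :=
        Finset.sum_le_sum fun p _ => mul_le_mul_of_nonneg_right (hφ p) (sq_nonneg _)
      _ = 2 * ∫ ω, f ω ^ 2 ∂P := by
        simp only [add_mul, Finset.sum_add_distrib]
        rw [e4, ← e1]; ring
  have hG : ∑ p ∈ s ×ˢ t, |D p| * p.2 ^ 2 ≤ 2 * φ * ∫ ω, g ω ^ 2 ∂P := by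
    rw [integral_comp_of_finite h₂ hg ht (fun a => a ^ 2), Finset.sum_product_right, Finset.mul_sum]
    refine Finset.sum_le_sum fun b _ => ?_
    dsimp only
    rw [← Finset.sum_mul, ← mul_assoc]
    refine mul_le_mul_of_nonneg_right ?_ (sq_nonneg b)
    have hT : MeasurableSet[m₂] (g ⁻¹' {b}) := hg (measurableSet_singleton b)
    exact sum_abs_deviation_le (T := g ⁻¹' {b}) h₁ hf s fun S hS => h S _ hS hT
  have hF0 : 0 ≤ 2 * ∫ ω, f ω ^ 2 ∂P :=
    mul_nonneg zero_le_two (integral_nonneg fun ω => sq_nonneg (f ω))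
  rw [hcov]
  clear_value D
  have hCS : (∑ p ∈ s ×ˢ t, D p * (p.1 * p.2)) ^ 2 ≤
      (∑ p ∈ s ×ˢ t, |D p| * p.1 ^ 2) * ∑ p ∈ s ×ˢ t, |D p| * p.2 ^ 2 := by
    refine Finset.sum_sq_le_sum_mul_sum_of_sq_le_mul _
      (fun p _ => mul_nonneg (abs_nonneg _) (sq_nonneg _))
      (fun p _ => mul_nonneg (abs_nonneg _) (sq_nonneg _)) fun p _ => ?_
    rw [mul_pow, ← sq_abs (D p)]
    exact le_of_eq (by ring)
  have hG0 : 0 ≤ ∑ p ∈ s ×ˢ t, |D p| * p.2 ^ 2 :=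
    Finset.sum_nonneg fun p _ => mul_nonneg (abs_nonneg _) (sq_nonneg _)
  calc _ ≤ _ := hCS
    _ ≤ (2 * ∫ ω, f ω ^ 2 ∂P) * (2 * φ * ∫ ω, g ω ^ 2 ∂P) := mul_le_mul hF hG hG0 hF0
    _ = _ := by ring

/-- The **Ibragimov–Linnik covariance inequality**. -/
theorem covariance_le_of_mixing (h₁ : m₁ ≤ m₀) (h₂ : m₂ ≤ m₀) [IsProbabilityMeasure P] {φ : ℝ}
    (h : ∀ S T, MeasurableSet[m₁] S → MeasurableSet[m₂] T →
      |P.real (S ∩ T) - P.real S * P.real T| ≤ φ * P.real T)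
    {f g : Ω → ℝ} (hf : Measurable[m₁] f) (hg : Measurable[m₂] g)
    (hf2 : MemLp f 2 P) (hg2 : MemLp g 2 P) :
    (∫ ω, f ω * g ω ∂P - (∫ ω, f ω ∂P) * ∫ ω, g ω ∂P) ^ 2
      ≤ 4 * φ * (∫ ω, f ω ^ 2 ∂P) * ∫ ω, g ω ^ 2 ∂P := by
  -- The approximants are built inside `m₁` and `m₂`, so that the hypothesis applies to their level
  -- sets.
  obtain ⟨F, hFm, hFs, hFb, hFt⟩ := @exists_finite_approx Ω m₁ f hf
  obtain ⟨G, hGm, hGs, hGb, hGt⟩ := @exists_finite_approx Ω m₂ g hg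
  have hFm' : ∀ k, AEStronglyMeasurable (F k) P :=
    fun k => ((hFm k).mono h₁ le_rfl).aestronglyMeasurable
  have hGm' : ∀ k, AEStronglyMeasurable (G k) P :=
    fun k => ((hGm k).mono h₂ le_rfl).aestronglyMeasurable
  have tfg : Tendsto (fun k => ∫ ω, F k ω * G k ω ∂P) atTop (𝓝 (∫ ω, f ω * g ω ∂P)) := by
    refine tendsto_integral_of_dominated_convergence (fun ω => 4 * ‖f ω * g ω‖)
      (fun k => (hFm' k).mul (hGm' k)) ((hf2.integrable_mul hg2).norm.const_mul 4)
      (fun k => ae_of_all _ fun ω => ?_) (ae_of_all _ fun ω => (hFt ω).mul (hGt ω))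
    rw [norm_mul, norm_mul]
    nlinarith [mul_le_mul (hFb k ω) (hGb k ω) (norm_nonneg _) (by positivity)]
  have tf : ∀ {f : Ω → ℝ} {F : ℕ → Ω → ℝ}, MemLp f 2 P → (∀ k, AEStronglyMeasurable (F k) P) →
      (∀ k ω, ‖F k ω‖ ≤ 2 * ‖f ω‖) → (∀ ω, Tendsto (fun k => F k ω) atTop (𝓝 (f ω))) →
      Tendsto (fun k => ∫ ω, F k ω ∂P) atTop (𝓝 (∫ ω, f ω ∂P)) ∧
      Tendsto (fun k => ∫ ω, F k ω ^ 2 ∂P) atTop (𝓝 (∫ ω, f ω ^ 2 ∂P)) := by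
    intro f F hf2 hFm hFb hFt
    refine ⟨tendsto_integral_of_dominated_convergence (fun ω => 2 * ‖f ω‖)
      hFm ((hf2.integrable one_le_two).norm.const_mul 2)
      (fun k => ae_of_all _ (hFb k)) (ae_of_all _ hFt),
      tendsto_integral_of_dominated_convergence (fun ω => 4 * f ω ^ 2)
      (fun k => (hFm k).pow 2) (hf2.integrable_sq.const_mul 4)
      (fun k => ae_of_all _ fun ω => ?_) (ae_of_all _ fun ω => (hFt ω).pow 2)⟩
    rw [norm_pow, ← sq_abs (f ω), ← Real.norm_eq_abs]
    nlinarith [pow_le_pow_left₀ (norm_nonneg _) (hFb k ω) 2]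
  obtain ⟨tf1, tf2⟩ := tf hf2 hFm' hFb hFt
  obtain ⟨tg1, tg2⟩ := tf hg2 hGm' hGb hGt
  refine le_of_tendsto_of_tendsto' ((tfg.sub (tf1.mul tg1)).pow 2)
    ((tf2.const_mul (4 * φ)).mul tg2) fun k => ?_
  obtain ⟨s, hs⟩ := hFs k
  obtain ⟨t, ht⟩ := hGs k
  exact covariance_of_finite_le h₁ h₂ h (hFm k) hs (hGm k) ht

end Mixing

/-! ### Random fields with bounded second moments, smeared by integrable weights. -/

section Fields

variable {n : ℕ} {Ω : Type*} [MeasurableSpace Ω] {P : Measure Ω}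

theorem enorm_complex_ofReal (x : ℝ) : ‖(x : ℂ)‖ₑ = ‖x‖ₑ := by
  simp [← ofReal_norm]

/-- Cauchy–Schwarz for the measure with density `g`. -/
theorem sq_lintegral_mul_le {α : Type*} [MeasurableSpace α] {μ : Measure α} {f g : α → ℝ≥0∞}
    (hf : AEMeasurable f μ) (hg : AEMeasurable g μ) :
    (∫⁻ x, f x * g x ∂μ) ^ 2 ≤ (∫⁻ x, f x ^ 2 * g x ∂μ) * ∫⁻ x, g x ∂μ := by
  have h := ENNReal.lintegral_mul_norm_pow_le (μ := μ) ((hf.pow_const 2).mul hg) hg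
    (p := 1 / 2) (q := 1 / 2) (by norm_num) (by norm_num) (by norm_num)
  have e : ∀ a b : ℝ≥0∞, (a ^ 2 * b) ^ (1 / 2 : ℝ) * b ^ (1 / 2 : ℝ) = a * b := by
    intro a b
    rw [ENNReal.mul_rpow_of_nonneg _ _ (by norm_num), mul_assoc,
      ← ENNReal.rpow_add_of_nonneg _ _ (by norm_num) (by norm_num), ← ENNReal.rpow_natCast,
      ← ENNReal.rpow_mul]
    norm_num
  simp only [Pi.mul_apply, e] at h
  have h2 := pow_le_pow_left' h 2
  refine h2.trans (le_of_eq ?_)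
  rw [← ENNReal.mul_rpow_of_nonneg _ _ (by norm_num), ← ENNReal.rpow_natCast, ← ENNReal.rpow_mul]
  norm_num

/-- A jointly measurable real random field whose second moments are bounded by `M`. -/
structure IsField (P : Measure Ω) (X : Ω → E n → ℝ) (M : ℝ≥0) : Prop where
  aesm : AEStronglyMeasurable (fun z : Ω × E n => X z.1 z.2) (P.prod volume)
  bound : ∀ᵐ x, ∫⁻ ω, ‖X ω x‖ₑ ^ 2 ∂P ≤ M

/-- The pairing of a real random field with a complex weight. -/
def smear (X : Ω → E n → ℝ) (ψ : E n → ℂ) (ω : Ω) : ℂ := ∫ x, (X ω x : ℂ) * ψ x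

variable [IsProbabilityMeasure P] {X X₁ X₂ : Ω → E n → ℝ} {M M₁ M₂ : ℝ≥0} {ψ ψ₁ ψ₂ : E n → ℂ}

omit [MeasurableSpace Ω] in
theorem smear_ofReal (X : Ω → E n → ℝ) (ψ : E n → ℝ) (ω : Ω) :
    smear X (fun x => (ψ x : ℂ)) ω = ((∫ x, X ω x * ψ x : ℝ) : ℂ) := by
  rw [smear, ← integral_complex_ofReal]
  simp

omit [IsProbabilityMeasure P] in
theorem IsField.aesm_mul (hX : IsField P X M) (hψ : AEStronglyMeasurable ψ volume) :
    AEStronglyMeasurable (fun z : Ω × E n => (X z.1 z.2 : ℂ) * ψ z.2) (P.prod volume) :=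
  (Complex.continuous_ofReal.comp_aestronglyMeasurable hX.aesm).mul hψ.comp_snd

omit [IsProbabilityMeasure P] in
theorem IsField.aesm_smear (hX : IsField P X M) (hψ : AEStronglyMeasurable ψ volume) :
    AEStronglyMeasurable (smear X ψ) P :=
  (hX.aesm_mul hψ).integral_prod_right'

/-- Cauchy–Schwarz in `x` with weight `|ψ|` for each `ω`, then Tonelli and the pointwise second
moment. -/
theorem IsField.lintegral_smear_sq_le (hX : IsField P X M) (hψ : AEStronglyMeasurable ψ volume) :
    ∫⁻ ω, ‖smear X ψ ω‖ₑ ^ 2 ∂P ≤ M * (∫⁻ x, ‖ψ x‖ₑ) ^ 2 := by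
  have h1 : ∀ᵐ ω ∂P, ‖smear X ψ ω‖ₑ ^ 2 ≤
      (∫⁻ x, ‖X ω x‖ₑ ^ 2 * ‖ψ x‖ₑ) * ∫⁻ x, ‖ψ x‖ₑ := by
    filter_upwards [hX.aesm.prodMk_left] with ω hω
    refine (pow_le_pow_left' (enorm_integral_le_lintegral_enorm _) 2).trans ?_
    simp only [enorm_mul, enorm_complex_ofReal]
    exact sq_lintegral_mul_le hω.enorm hψ.enorm
  have hm : AEMeasurable (fun z : Ω × E n => ‖X z.1 z.2‖ₑ ^ 2 * ‖ψ z.2‖ₑ) (P.prod volume) :=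
    (hX.aesm.enorm.pow_const 2).mul hψ.comp_snd.enorm
  refine (lintegral_mono_ae h1).trans ?_
  rw [lintegral_mul_const'' _ hm.lintegral_prod_right', pow_two, ← mul_assoc]
  gcongr
  rw [lintegral_lintegral_swap hm, ← lintegral_const_mul'' _ hψ.enorm]
  refine lintegral_mono_ae ?_
  filter_upwards [hX.bound, hX.aesm.prodMk_right] with x hx hxm
  rw [lintegral_mul_const'' _ (hxm.enorm.pow_const 2)]
  gcongr

theorem IsField.memLp_smear (hX : IsField P X M) (hψ : Integrable ψ) : MemLp (smear X ψ) 2 P := by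
  refine ⟨hX.aesm_smear hψ.1, ?_⟩
  rw [eLpNorm_lt_top_iff_lintegral_rpow_enorm_lt_top (by norm_num) (by norm_num)]
  simp only [ENNReal.toReal_ofNat, ENNReal.rpow_ofNat]
  exact (hX.lintegral_smear_sq_le hψ.1).trans_lt
    (ENNReal.mul_lt_top ENNReal.coe_lt_top (ENNReal.pow_lt_top hψ.2))

theorem IsField.aesm_prod (hX₁ : IsField P X₁ M₁) (hX₂ : IsField P X₂ M₂) :
    AEStronglyMeasurable (fun z : Ω × E n × E n => X₁ z.1 z.2.1 * X₂ z.1 z.2.2)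
      (P.prod (volume.prod volume)) := by
  have h1 := (hX₁.aesm).comp_quasiMeasurePreserving
    (QuasiMeasurePreserving.prodMap (.id P) (Measure.quasiMeasurePreserving_fst
      (μ := (volume : Measure (E n))) (ν := (volume : Measure (E n)))))
  have h2 := (hX₂.aesm).comp_quasiMeasurePreserving
    (QuasiMeasurePreserving.prodMap (.id P) (Measure.quasiMeasurePreserving_snd
      (μ := (volume : Measure (E n))) (ν := (volume : Measure (E n)))))
  exact h1.mul h2

theorem IsField.lintegral_mul_le (hX₁ : IsField P X₁ M₁) (hX₂ : IsField P X₂ M₂) :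
    ∀ᵐ z : E n × E n, ∫⁻ ω, ‖X₁ ω z.1 * X₂ ω z.2‖ₑ ∂P ≤ M₁ + M₂ := by
  have e1 := Measure.quasiMeasurePreserving_fst
      (μ := (volume : Measure (E n))) (ν := (volume : Measure (E n)))
  have e2 := Measure.quasiMeasurePreserving_snd
      (μ := (volume : Measure (E n))) (ν := (volume : Measure (E n)))
  filter_upwards [e1.ae hX₁.bound, e2.ae hX₂.bound, e1.ae hX₁.aesm.prodMk_right] with z h1 h2 h3
  have : ∀ ω, ‖X₁ ω z.1 * X₂ ω z.2‖ₑ ≤ ‖X₁ ω z.1‖ₑ ^ 2 + ‖X₂ ω z.2‖ₑ ^ 2 := by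
    intro ω
    rw [enorm_mul]
    rcases le_total ‖X₁ ω z.1‖ₑ ‖X₂ ω z.2‖ₑ with h | h
    · exact le_add_left (by rw [pow_two]; gcongr)
    · exact le_add_right (by rw [pow_two]; gcongr)
  refine (lintegral_mono this).trans ?_
  rw [lintegral_add_left' (h3.enorm.pow_const 2)]
  gcongr

theorem IsField.integrable_prod (hX₁ : IsField P X₁ M₁) (hX₂ : IsField P X₂ M₂)
    (hψ₁ : Integrable ψ₁) (hψ₂ : Integrable ψ₂) :
    Integrable (fun z : Ω × E n × E n =>
      ((X₁ z.1 z.2.1 * X₂ z.1 z.2.2 : ℝ) : ℂ) * (ψ₁ z.2.1 * ψ₂ z.2.2))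
      (P.prod (volume.prod volume)) := by
  have hψ := hψ₁.mul_prod hψ₂
  have hm : AEStronglyMeasurable (fun z : Ω × E n × E n =>
      ((X₁ z.1 z.2.1 * X₂ z.1 z.2.2 : ℝ) : ℂ) * (ψ₁ z.2.1 * ψ₂ z.2.2))
      (P.prod (volume.prod volume)) :=
    (Complex.continuous_ofReal.comp_aestronglyMeasurable (hX₁.aesm_prod hX₂)).mul
      (hψ.1.comp_snd (μ := P))
  refine ⟨hm, ?_⟩
  rw [hasFiniteIntegral_iff_enorm]
  refine (lintegral_prod_symm _ hm.enorm).trans_lt ?_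
  refine lt_of_le_of_lt (b := ∫⁻ z : E n × E n, (M₁ + M₂) * ‖ψ₁ z.1 * ψ₂ z.2‖ₑ
    ∂(volume.prod volume)) (lintegral_mono_ae ?_) ?_
  · filter_upwards [hX₁.lintegral_mul_le hX₂, (hX₁.aesm_prod hX₂).prodMk_right] with z hz hzm
    simp only [enorm_mul, Complex.ofReal_mul, enorm_complex_ofReal]
    simp only [enorm_mul] at hz
    rw [lintegral_mul_const'']
    · gcongr
    · simpa using hzm.enorm
  · rw [lintegral_const_mul'' _ hψ.1.enorm]
    exact ENNReal.mul_lt_top (by simp) hψ.2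

/-- Covariance of smeared fields. -/
theorem IsField.integral_smear_mul_smear (hX₁ : IsField P X₁ M₁) (hX₂ : IsField P X₂ M₂)
    {q : E n → ℝ} (hq : ∀ᵐ z : E n × E n, ∫ ω, X₁ ω z.1 * X₂ ω z.2 ∂P = q (z.1 - z.2))
    (hψ₁ : Integrable ψ₁) (hψ₂ : Integrable ψ₂) :
    ∫ ω, smear X₁ ψ₁ ω * smear X₂ ψ₂ ω ∂P =
      ∫ z : E n × E n, (q (z.1 - z.2) : ℂ) * (ψ₁ z.1 * ψ₂ z.2) := by
  have hint := hX₁.integrable_prod hX₂ hψ₁ hψ₂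
  calc _ = ∫ ω, ∫ z : E n × E n, ((X₁ ω z.1 * X₂ ω z.2 : ℝ) : ℂ) * (ψ₁ z.1 * ψ₂ z.2)
        ∂(volume.prod volume) ∂P := by
        refine integral_congr_ae (ae_of_all _ fun ω => ?_)
        simp only [smear]
        rw [← integral_prod_mul]
        refine integral_congr_ae (ae_of_all _ fun z => ?_)
        simp only [Complex.ofReal_mul]
        ring
    _ = ∫ z : E n × E n, ∫ ω, ((X₁ ω z.1 * X₂ ω z.2 : ℝ) : ℂ) * (ψ₁ z.1 * ψ₂ z.2) ∂P :=
        integral_integral_swap hint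
    _ = _ := by
        refine integral_congr_ae ?_
        filter_upwards [hq] with z hz
        rw [integral_mul_const, integral_complex_ofReal, hz]

/-- A property of differences which holds for almost all pairs holds almost everywhere. -/
theorem ae_of_ae_sub {p : E n → Prop} (h : ∀ᵐ z : E n × E n, p (z.1 - z.2)) : ∀ᵐ x : E n, p x := by
  have h1 := (measurePreserving_add_prod (volume : Measure (E n))
    (volume : Measure (E n))).quasiMeasurePreserving.ae h
  simp only [add_sub_cancel_right] at h1
  filter_upwards [Measure.ae_ae_of_ae_prod h1] with x hx
  exact hx.exists.choose_spec

/-- Measurability of `q` is not assumed. The shear `(x, y) ↦ (x + y, y)` turns `q (x - y)` into a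
function of the first variable alone, and measurability descends from the product. -/
theorem IsField.aesm_cov (hX₁ : IsField P X₁ M₁) (hX₂ : IsField P X₂ M₂)
    {q : E n → ℝ} (hq : ∀ᵐ z : E n × E n, ∫ ω, X₁ ω z.1 * X₂ ω z.2 ∂P = q (z.1 - z.2)) :
    AEStronglyMeasurable q volume := by
  have hmp := (measurePreserving_add_prod (volume : Measure (E n))
    (volume : Measure (E n))).quasiMeasurePreserving
  have h1 := hmp.ae hq
  simp only [add_sub_cancel_right] at h1
  have hF := (hX₁.aesm_prod hX₂).prod_swap.integral_prod_right'.comp_quasiMeasurePreserving hmp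
  have := hF.congr h1
  exact this.of_comp_fst (NeZero.ne _)

theorem IsField.ae_abs_cov_le (hX₁ : IsField P X₁ M₁) (hX₂ : IsField P X₂ M₂)
    {q : E n → ℝ} (hq : ∀ᵐ z : E n × E n, ∫ ω, X₁ ω z.1 * X₂ ω z.2 ∂P = q (z.1 - z.2)) :
    ∀ᵐ x, |q x| ≤ M₁ + M₂ := by
  apply ae_of_ae_sub
  filter_upwards [hq, hX₁.lintegral_mul_le hX₂] with z hz h
  have := (enorm_integral_le_lintegral_enorm (μ := P) fun ω => X₁ ω z.1 * X₂ ω z.2).trans h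
  rw [hz] at this
  have h2 := ENNReal.toReal_mono (by simp) this
  simpa [ENNReal.toReal_add] using h2

theorem IsField.integral_smear_eq_zero (hX : IsField P X M) (h0 : ∀ᵐ x : E n, ∫ ω, X ω x ∂P = 0)
    (hψ : Integrable ψ) : ∫ ω, smear X ψ ω ∂P = 0 := by
  have hint : Integrable (fun z : Ω × E n => (X z.1 z.2 : ℂ) * ψ z.2) (P.prod volume) := by
    have hm := hX.aesm_mul hψ.1
    refine ⟨hm, ?_⟩
    rw [hasFiniteIntegral_iff_enorm]
    refine (lintegral_prod_symm _ hm.enorm).trans_lt ?_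
    refine lt_of_le_of_lt (b := ∫⁻ x : E n, (1 + M) * ‖ψ x‖ₑ) (lintegral_mono_ae ?_) ?_
    · filter_upwards [hX.bound, hX.aesm.prodMk_right] with x hx hxm
      simp only [enorm_mul, enorm_complex_ofReal]
      rw [lintegral_mul_const'' _ hxm.enorm]
      gcongr
      have : ∀ ω, ‖X ω x‖ₑ ≤ 1 + ‖X ω x‖ₑ ^ 2 := by
        intro ω
        rcases le_total ‖X ω x‖ₑ 1 with h | h
        · exact le_add_right h
        · exact le_add_left (by rw [pow_two]; exact le_mul_of_one_le_left' h)
      refine (lintegral_mono this).trans ?_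
      rw [lintegral_add_right' _ (hxm.enorm.pow_const 2)]
      simp only [lintegral_const, measure_univ, mul_one]
      gcongr
    · rw [lintegral_const_mul'' _ hψ.1.enorm]
      exact ENNReal.mul_lt_top (by simp) hψ.2
  calc _ = ∫ x, ∫ ω, (X ω x : ℂ) * ψ x ∂P := integral_integral_swap hint
    _ = ∫ x : E n, (0 : ℂ) := by
        refine integral_congr_ae ?_
        filter_upwards [h0] with x hx
        rw [integral_mul_const, integral_complex_ofReal, hx]
        simp
    _ = 0 := by simp

end Fields

/-! ### The mixing coefficient and covariances of separated smearings. -/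

section MixingCoeff

variable {n : ℕ} {Ω : Type*} [MeasurableSpace Ω] {P : Measure Ω} {Y : Fin 2 → Ω → E n → ℝ}

theorem sigmaAlg_le (hY : IsRandomState P Y) (A : Set (E n)) :
    sigmaAlg Y A ≤ (inferInstance : MeasurableSpace Ω) := by
  refine iSup₂_le fun Ψ hΨ => ?_
  have h := hY.measurable_pairing Ψ fun i => (hΨ i).1
  rw [measurable_iff_comap_le] at h
  rwa [← BorelSpace.measurable_eq]

theorem isTest_zero : IsTest (fun _ : E n => (0 : ℝ)) :=
  ⟨contDiff_const, HasCompactSupport.zero⟩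

omit [MeasurableSpace Ω] in
theorem measurable_integral_mul_of_tsupport_subset {A : Set (E n)} {ψ : E n → ℝ} (hψ : IsTest ψ)
    (hA : tsupport ψ ⊆ A) (i : Fin 2) :
    Measurable[sigmaAlg Y A] (fun ω => ∫ x, Y i ω x * ψ x) := by
  set Ψ : Fin 2 → E n → ℝ := fun j => if j = i then ψ else fun _ => 0 with hΨ
  have h1 : ∀ j, IsTest (Ψ j) ∧ tsupport (Ψ j) ⊆ A := by
    intro j
    by_cases h : j = i
    · simp only [hΨ, h, if_true]
      exact ⟨hψ, hA⟩
    · simp only [hΨ, h, if_false]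
      refine ⟨isTest_zero, ?_⟩
      have : tsupport (fun _ : E n => (0 : ℝ)) = ∅ := tsupport_eq_empty_iff.2 rfl
      simp [this]
  have h2 : (fun ω => ∫ x, Y i ω x * ψ x) = fun ω => pairing (fun i => Y i ω) Ψ := by
    funext ω
    rw [pairing, Finset.sum_eq_single i]
    · simp [hΨ]
    · intro j _ hj
      simp [hΨ, hj]
    · simp
  rw [h2, measurable_iff_comap_le, BorelSpace.measurable_eq (α := ℝ)]
  exact le_iSup₂_of_le Ψ h1 le_rfl

variable [IsProbabilityMeasure P]

/-- Boundedness makes the `sSup` in `mixingCoeff` a genuine supremum rather than the default value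
`0`. -/
theorem mixing_quotient_le_one (S T : Set Ω) :
    |P.real (S ∩ T) - P.real S * P.real T| / P.real T ≤ 1 := by
  refine div_le_one_of_le₀ ?_ measureReal_nonneg
  have h1 : P.real (S ∩ T) ≤ P.real T := measureReal_mono Set.inter_subset_right
  have h2 : P.real S * P.real T ≤ P.real T :=
    mul_le_of_le_one_left measureReal_nonneg measureReal_le_one
  have h3 : 0 ≤ P.real S * P.real T := mul_nonneg measureReal_nonneg measureReal_nonneg
  have h4 : 0 ≤ P.real (S ∩ T) := measureReal_nonneg
  rw [abs_le]
  constructor <;> linarith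

theorem bddAbove_mixing (P : Measure Ω) [IsProbabilityMeasure P] (Y : Fin 2 → Ω → E n → ℝ)
    (r : ℝ) :
    BddAbove {c : ℝ | ∃ A B : Set (E n), IsOpen A ∧ IsOpen B ∧ (∀ x ∈ A, ∀ y ∈ B, r ≤ dist x y) ∧
    ∃ S T : Set Ω, MeasurableSet[sigmaAlg Y A] S ∧ MeasurableSet[sigmaAlg Y B] T ∧
      0 < P.real T ∧ c = |P.real (S ∩ T) - P.real S * P.real T| / P.real T} := by
  refine ⟨1, ?_⟩
  rintro c ⟨A, B, -, -, -, S, T, -, -, -, rfl⟩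
  exact mixing_quotient_le_one S T

theorem zero_mem_mixing (P : Measure Ω) [IsProbabilityMeasure P] (Y : Fin 2 → Ω → E n → ℝ)
    (r : ℝ) :
    (0 : ℝ) ∈ {c : ℝ | ∃ A B : Set (E n), IsOpen A ∧ IsOpen B ∧
      (∀ x ∈ A, ∀ y ∈ B, r ≤ dist x y) ∧
    ∃ S T : Set Ω, MeasurableSet[sigmaAlg Y A] S ∧ MeasurableSet[sigmaAlg Y B] T ∧
      0 < P.real T ∧ c = |P.real (S ∩ T) - P.real S * P.real T| / P.real T} :=
  ⟨∅, ∅, isOpen_empty, isOpen_empty, by simp, Set.univ, Set.univ, MeasurableSet.univ,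
    MeasurableSet.univ, by simp, by simp⟩

theorem mixingCoeff_nonneg (P : Measure Ω) [IsProbabilityMeasure P] (Y : Fin 2 → Ω → E n → ℝ)
    (r : ℝ) : 0 ≤ mixingCoeff P Y r :=
  le_csSup (bddAbove_mixing P Y r) (zero_mem_mixing P Y r)

theorem mixingCoeff_le_one (P : Measure Ω) [IsProbabilityMeasure P] (Y : Fin 2 → Ω → E n → ℝ)
    (r : ℝ) : mixingCoeff P Y r ≤ 1 := by
  refine csSup_le ⟨0, zero_mem_mixing P Y r⟩ ?_
  rintro c ⟨A, B, -, -, -, S, T, -, -, -, rfl⟩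
  exact mixing_quotient_le_one S T

theorem mixingCoeff_antitone (P : Measure Ω) [IsProbabilityMeasure P]
    (Y : Fin 2 → Ω → E n → ℝ) : Antitone (mixingCoeff P Y) := by
  intro r s hrs
  refine csSup_le_csSup (bddAbove_mixing P Y r) ⟨0, zero_mem_mixing P Y s⟩ ?_
  rintro c ⟨A, B, hA, hB, hd, h⟩
  exact ⟨A, B, hA, hB, fun x hx y hy => hrs.trans (hd x hx y hy), h⟩

theorem deviation_le_mixingCoeff {r : ℝ} {A B : Set (E n)} (hA : IsOpen A) (hB : IsOpen B)
    (hd : ∀ x ∈ A, ∀ y ∈ B, r ≤ dist x y) {S T : Set Ω} (hS : MeasurableSet[sigmaAlg Y A] S)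
    (hT : MeasurableSet[sigmaAlg Y B] T) :
    |P.real (S ∩ T) - P.real S * P.real T| ≤ mixingCoeff P Y r * P.real T := by
  -- Null sets `T` are excluded from the supremum, but for them both sides vanish.
  rcases (measureReal_nonneg (μ := P) (s := T)).eq_or_lt with h | h
  · have : P.real (S ∩ T) = 0 :=
      le_antisymm (h ▸ measureReal_mono Set.inter_subset_right) measureReal_nonneg
    simp [this, ← h]
  · rw [← div_le_iff₀ h]
    exact le_csSup (bddAbove_mixing P Y r) ⟨A, B, hA, hB, hd, S, T, hS, hT, h, rfl⟩

omit [IsProbabilityMeasure P] in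
theorem IsRandomState.isField (hY : IsRandomState P Y) {e₀ : ℝ≥0}
    (he : HasMeanEnergyDensity P Y e₀) (i : Fin 2) : IsField P (Y i) e₀ := by
  refine ⟨(hY.aemeasurable i).aestronglyMeasurable, ?_⟩
  obtain ⟨G, -, -, h⟩ := he
  filter_upwards [h] with x hx
  rw [← hx]
  refine lintegral_mono fun ω => ?_
  fin_cases i
  · exact le_add_self
  · exact le_add_right le_self_add

theorem IsTest.integrable {ψ : E n → ℝ} (hψ : IsTest ψ) : Integrable ψ :=
  hψ.1.continuous.integrable_of_hasCompactSupport hψ.2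

theorem IsField.memLp_integral_mul {X : Ω → E n → ℝ} {M : ℝ≥0} (hX : IsField P X M) {ψ : E n → ℝ}
    (hψ : Integrable ψ) : MemLp (fun ω => ∫ x, X ω x * ψ x) 2 P := by
  have := (hX.memLp_smear hψ.ofReal).re
  simpa [smear_ofReal] using this

theorem IsField.integral_sq_le {X : Ω → E n → ℝ} {M : ℝ≥0} (hX : IsField P X M) {ψ : E n → ℝ}
    (hψ : Integrable ψ) (h0 : ∀ x, 0 ≤ ψ x) (h1 : ∫ x, ψ x = 1) :
    ∫ ω, (∫ x, X ω x * ψ x) ^ 2 ∂P ≤ M := by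
  have h := hX.lintegral_smear_sq_le hψ.ofReal.1
  have e1 : ∫⁻ x, ‖(ψ x : ℂ)‖ₑ = 1 := by
    simp only [enorm_complex_ofReal]
    rw [← ofReal_integral_norm_eq_lintegral_enorm hψ]
    simp [abs_of_nonneg (h0 _), h1]
  have e2 := (hX.memLp_integral_mul hψ).integrable_sq
  rw [integral_eq_lintegral_of_nonneg_ae (ae_of_all _ fun ω => sq_nonneg _) e2.1]
  refine ENNReal.toReal_le_coe_of_le_coe (le_trans (le_of_eq ?_) (h.trans (by simp [e1])))
  refine lintegral_congr fun ω => ?_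
  erw [smear_ofReal, enorm_complex_ofReal]
  rw [Real.enorm_eq_ofReal_abs, ← ENNReal.ofReal_pow (abs_nonneg _), sq_abs]
  rfl

theorem IsField.integral_mul_mul {X₁ X₂ : Ω → E n → ℝ} {M₁ M₂ : ℝ≥0} (hX₁ : IsField P X₁ M₁)
    (hX₂ : IsField P X₂ M₂) {q : E n → ℝ}
    (hq : ∀ᵐ z : E n × E n, ∫ ω, X₁ ω z.1 * X₂ ω z.2 ∂P = q (z.1 - z.2)) {ψ₁ ψ₂ : E n → ℝ}
    (hψ₁ : Integrable ψ₁) (hψ₂ : Integrable ψ₂) :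
    ∫ ω, (∫ x, X₁ ω x * ψ₁ x) * (∫ x, X₂ ω x * ψ₂ x) ∂P =
      ∫ z : E n × E n, q (z.1 - z.2) * (ψ₁ z.1 * ψ₂ z.2) := by
  have h := hX₁.integral_smear_mul_smear hX₂ hq hψ₁.ofReal hψ₂.ofReal
  apply Complex.ofReal_injective
  rw [← integral_complex_ofReal, ← integral_complex_ofReal]
  simp only [Complex.ofReal_mul, ← smear_ofReal]
  exact h

/-- Zero mean makes the mixed second moment a covariance, and weights of mass one keep both second
moments below `e₀`. -/
theorem abs_cov_smear_le (hY : IsRandomState P Y) {e₀ : ℝ≥0} (hz : ZeroMean P Y)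
    (he : HasMeanEnergyDensity P Y e₀) {q : Fin 2 → Fin 2 → E n → ℝ} (hq : HasCovariance P Y q)
    (i j : Fin 2) {r : ℝ} {A B : Set (E n)} (hA : IsOpen A) (hB : IsOpen B)
    (hd : ∀ x ∈ A, ∀ y ∈ B, r ≤ dist x y) {ψ₁ ψ₂ : E n → ℝ} (h₁ : IsTest ψ₁) (h₂ : IsTest ψ₂)
    (hψA : tsupport ψ₁ ⊆ A) (hψB : tsupport ψ₂ ⊆ B) (n₁ : ∀ x, 0 ≤ ψ₁ x) (n₂ : ∀ x, 0 ≤ ψ₂ x)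
    (i₁ : ∫ x, ψ₁ x = 1) (i₂ : ∫ x, ψ₂ x = 1) :
    |∫ z : E n × E n, q i j (z.1 - z.2) * (ψ₁ z.1 * ψ₂ z.2)|
      ≤ 2 * e₀ * √(mixingCoeff P Y r) := by
  have f₁ := hY.isField he i
  have f₂ := hY.isField he j
  have key := covariance_le_of_mixing (sigmaAlg_le hY A) (sigmaAlg_le hY B)
    (fun S T hS hT => deviation_le_mixingCoeff hA hB hd hS hT)
    (measurable_integral_mul_of_tsupport_subset h₁ hψA i)
    (measurable_integral_mul_of_tsupport_subset h₂ hψB j)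
    (f₁.memLp_integral_mul h₁.integrable) (f₂.memLp_integral_mul h₂.integrable)
  have z₁ : ∫ ω, (∫ x, Y i ω x * ψ₁ x) ∂P = 0 := by
    have := f₁.integral_smear_eq_zero (hz i) h₁.integrable.ofReal
    apply Complex.ofReal_injective
    rw [← integral_complex_ofReal]
    simp only [← smear_ofReal]
    exact this
  rw [z₁, zero_mul, sub_zero, f₁.integral_mul_mul f₂ (hq i j) h₁.integrable h₂.integrable] at key
  have hφ := mixingCoeff_nonneg P Y r
  have b₁ := f₁.integral_sq_le h₁.integrable n₁ i₁
  have b₂ := f₂.integral_sq_le h₂.integrable n₂ i₂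
  refine abs_le_of_sq_le_sq ?_ (by positivity)
  calc _ ≤ _ := key
    _ ≤ 4 * mixingCoeff P Y r * e₀ * e₀ := by
      gcongr
    _ = _ := by
      rw [mul_pow, Real.sq_sqrt hφ]; ring

end MixingCoeff

/-! ### Mollifiers and double smearing of a bounded function of the difference. -/

section Mollifier

variable {n : ℕ}

/-- A family of smooth bumps shrinking to the origin. -/
def bump (n k : ℕ) : ContDiffBump (0 : E n) where
  rIn := 1 / (2 * (k + 1))
  rOut := 1 / (k + 1)
  rIn_pos := by positivity
  rIn_lt_rOut := by
    apply one_div_lt_one_div_of_lt <;> nlinarith [(Nat.cast_nonneg k : (0 : ℝ) ≤ k)]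

/-- The normalized bumps. -/
def mollifier (n k : ℕ) : E n → ℝ := (bump n k).normed volume

theorem tendsto_rOut_bump (n : ℕ) : Tendsto (fun k => (bump n k).rOut) atTop (𝓝 0) :=
  tendsto_one_div_add_atTop_nhds_zero_nat

theorem isTest_mollifier (n k : ℕ) : IsTest (mollifier n k) :=
  ⟨(bump n k).contDiff_normed, (bump n k).hasCompactSupport_normed⟩

theorem mollifier_nonneg (n k : ℕ) (x : E n) : 0 ≤ mollifier n k x := (bump n k).nonneg_normed x

theorem integral_mollifier (n k : ℕ) : ∫ x, mollifier n k x = 1 := (bump n k).integral_normed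

theorem IsTest.comp_sub {ψ : E n → ℝ} (h : IsTest ψ) (z : E n) : IsTest (fun x => ψ (x - z)) :=
  ⟨h.1.comp (contDiff_id.sub contDiff_const), h.2.comp_homeomorph (Homeomorph.subRight z)⟩

theorem tsupport_mollifier_sub_subset (k : ℕ) (z : E n) :
    tsupport (fun x => mollifier n k (x - z)) ⊆ Metric.closedBall z (bump n k).rOut := by
  refine closure_minimal (fun x hx => ?_) Metric.isClosed_closedBall
  have : x - z ∈ Function.support (mollifier n k) := hx
  rw [mollifier, ContDiffBump.support_normed_eq, Metric.mem_ball, dist_zero_right] at this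
  rw [Metric.mem_closedBall, dist_eq_norm]
  exact this.le

theorem quasiMeasurePreserving_sub_prod (n : ℕ) :
    Measure.QuasiMeasurePreserving (fun z : E n × E n => z.1 - z.2)
      (volume.prod volume) volume :=
  quasiMeasurePreserving_sub _ _

theorem integrable_bdd_sub_mul {q : E n → ℝ} (hm : AEStronglyMeasurable q volume) {K : ℝ}
    (hK : ∀ᵐ x, |q x| ≤ K) {F : E n × E n → ℂ} (hF : Integrable F (volume.prod volume)) :
    Integrable (fun z : E n × E n => (q (z.1 - z.2) : ℂ) * F z) (volume.prod volume) := by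
  refine hF.bdd_mul (c := K) (Complex.continuous_ofReal.comp_aestronglyMeasurable
    (hm.comp_quasiMeasurePreserving (quasiMeasurePreserving_sub_prod n))) ?_
  filter_upwards [(quasiMeasurePreserving_sub_prod n).ae hK] with z hz
  simpa using hz

theorem locallyIntegrable_of_ae_abs_le {q : E n → ℝ} (hm : AEStronglyMeasurable q volume) {K : ℝ}
    (hK : ∀ᵐ x, |q x| ≤ K) : LocallyIntegrable q volume :=
  (memLp_top_of_bound hm K hK).locallyIntegrable le_top

/-- The double convolution of a bounded function with mollifiers. -/
theorem integral_sub_mul_mollifier {q : E n → ℝ} (hm : AEStronglyMeasurable q volume) {K : ℝ}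
    (hK : ∀ᵐ x, |q x| ≤ K) (k l : ℕ) (z₀ : E n) :
    ∫ z : E n × E n, q (z.1 - z.2) * (mollifier n k (z.1 - z₀) * mollifier n l z.2) =
      convolution (mollifier n l) (convolution (mollifier n k) q (ContinuousLinearMap.lsmul ℝ ℝ)
        volume) (ContinuousLinearMap.lsmul ℝ ℝ) volume z₀ := by
  have hint : Integrable (fun z : E n × E n =>
      q (z.1 - z.2) * (mollifier n k (z.1 - z₀) * mollifier n l z.2)) (volume.prod volume) := by
    have h := ((isTest_mollifier n k).comp_sub z₀).integrable.mul_prod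
      (isTest_mollifier n l).integrable
    refine h.bdd_mul (c := K)
      (hm.comp_quasiMeasurePreserving (quasiMeasurePreserving_sub_prod n)) ?_
    filter_upwards [(quasiMeasurePreserving_sub_prod n).ae hK] with z hz
    simpa using hz
  rw [Measure.volume_eq_prod, integral_prod_symm _ hint, convolution_def]
  refine integral_congr_ae (ae_of_all _ fun y => ?_)
  simp only [ContinuousLinearMap.lsmul_apply, smul_eq_mul]
  rw [convolution_eq_swap]
  simp only [ContinuousLinearMap.lsmul_apply, smul_eq_mul]
  rw [← integral_const_mul, ← integral_add_right_eq_self (fun x => q (x - y) * _) y]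
  refine integral_congr_ae (ae_of_all _ fun x => ?_)
  simp only [add_sub_cancel_right]
  have : mollifier n k (x + y - z₀) = mollifier n k (z₀ - y - x) := by
    rw [mollifier, ← ContDiffBump.normed_neg]
    congr 1
    abel
  rw [this]
  ring

end Mollifier

/-! ### Pointwise decay of the covariance. -/

section Pointwise

variable {n : ℕ} {Ω : Type*} [MeasurableSpace Ω] {P : Measure Ω} {Y : Fin 2 → Ω → E n → ℝ}
  [IsProbabilityMeasure P]

/-- The covariance decays at the rate of the square root of the mixing coefficient. -/
theorem ae_abs_cov_le_mixing (hn : 1 ≤ n) (hY : IsRandomState P Y) {e₀ : ℝ≥0} (hz : ZeroMean P Y)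
    (he : HasMeanEnergyDensity P Y e₀) {q : Fin 2 → Fin 2 → E n → ℝ} (hq : HasCovariance P Y q)
    (i j : Fin 2) : ∀ᵐ x, |q i j x| ≤ 2 * e₀ * √(mixingCoeff P Y (‖x‖ / 2)) := by
  have hm := (hY.isField he i).aesm_cov (hY.isField he j) (hq i j)
  have hK := (hY.isField he i).ae_abs_cov_le (hY.isField he j) (hq i j)
  have hloc := locallyIntegrable_of_ae_abs_le hm hK
  -- Lebesgue differentiation removes the `k`-mollifier at almost every point; `K = 2` is the ratio
  -- of the radii of `bump`. The `l`-mollifier acts on a continuous function and is removed first,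
  -- with `k` fixed.
  have hlim := ContDiffBump.ae_convolution_tendsto_right_of_locallyIntegrable (μ := volume)
    (φ := bump n) (l := atTop) (K := 2) (tendsto_rOut_bump n)
    (Eventually.of_forall fun k => by
      simp only [bump]
      rw [one_div, one_div, mul_inv]
      linarith) hloc
  have : NeZero n := ⟨by omega⟩
  have hne : ∀ᵐ x : E n, x ≠ 0 := by
    simp [ae_iff]
  filter_upwards [hlim, hne] with z hz₀ hz₁
  -- Balls of radius `‖z‖ / 4` about `z` and `0` are at distance at least `‖z‖ / 2`, the argument of
  -- the mixing coefficient.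
  have hpos : 0 < ‖z‖ / 4 := by positivity
  refine le_of_tendsto hz₀.abs ?_
  filter_upwards [(tendsto_rOut_bump n).eventually_lt_const hpos] with k hk
  have hcont : Continuous (convolution (mollifier n k) (q i j) (ContinuousLinearMap.lsmul ℝ ℝ)
      volume) := (isTest_mollifier n k).2.continuous_convolution_left _
        (isTest_mollifier n k).1.continuous hloc
  have h2 := ContDiffBump.convolution_tendsto_right_of_continuous (μ := volume)
    (tendsto_rOut_bump n) hcont z
  refine le_of_tendsto h2.abs ?_
  filter_upwards [(tendsto_rOut_bump n).eventually_lt_const hpos] with l hl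
  have e := integral_sub_mul_mollifier hm hK k l z
  rw [mollifier] at e
  erw [← e]
  refine abs_cov_smear_le hY hz he hq i j (A := Metric.ball z (‖z‖ / 4))
    (B := Metric.ball 0 (‖z‖ / 4)) Metric.isOpen_ball Metric.isOpen_ball ?_
    ((isTest_mollifier n k).comp_sub z) (isTest_mollifier n l)
    ((tsupport_mollifier_sub_subset k z).trans (Metric.closedBall_subset_ball hk)) ?_
    (fun x => mollifier_nonneg n k _) (mollifier_nonneg n l) ?_ (integral_mollifier n l)
  · intro x hx y hy
    rw [Metric.mem_ball] at hx hy
    have h1 := dist_triangle4 z x y 0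
    rw [dist_zero_right, dist_comm z x] at h1
    linarith
  · have := tsupport_mollifier_sub_subset (n := n) l 0
    simp only [sub_zero] at this
    exact this.trans (Metric.closedBall_subset_ball hl)
  · rw [integral_sub_right_eq_self (mollifier n k) z]
    exact integral_mollifier n k

end Pointwise

/-! ### Integrability consequences of the mixing rate. -/

section Radial

variable {n : ℕ} {φ : ℝ → ℝ}

/-- The integrand is at most `1` on `(0, 1]`, and beyond `1` the power `n - 2` dominates. -/
theorem integrableOn_pow_mul_sqrt (hφ : Antitone φ) (h1 : ∀ r, φ r ≤ 1)
    (hint : IntegrableOn (fun r : ℝ => r ^ (n - 2) * √(φ r)) (Set.Ioi 0)) {k : ℕ}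
    (hk : k ≤ n - 2) : IntegrableOn (fun r : ℝ => r ^ k * √(φ r)) (Set.Ioi 0) := by
  have hc : IntegrableOn ((Set.Ioc (0 : ℝ) 1).indicator fun _ => (1 : ℝ)) (Set.Ioi 0) :=
    ((integrable_indicator_iff measurableSet_Ioc).2 (by simp)).integrableOn
  refine Integrable.mono' (hc.add hint) ?_ ?_
  · exact ((measurable_id.pow_const k).mul hφ.measurable.sqrt).aestronglyMeasurable
  · filter_upwards [ae_restrict_mem measurableSet_Ioi] with r hr
    have hr : 0 < r := hr
    have hs : √(φ r) ≤ 1 := Real.sqrt_le_one.2 (h1 r)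
    have hs0 := Real.sqrt_nonneg (φ r)
    rw [Real.norm_of_nonneg (by positivity), Pi.add_apply]
    by_cases hr1 : r ≤ 1
    · rw [Set.indicator_of_mem (Set.mem_Ioc.2 ⟨hr, hr1⟩)]
      have : r ^ k * √(φ r) ≤ 1 * 1 :=
        mul_le_mul (pow_le_one₀ hr.le hr1) hs hs0 zero_le_one
      have h3 : 0 ≤ r ^ (n - 2) * √(φ r) := by positivity
      linarith
    · rw [Set.indicator_of_notMem (fun h => hr1 h.2), zero_add]
      gcongr
      exact (not_le.1 hr1).le

/-- By monotonicity `√(φ r)` times the integral of `s ^ (n - 2)` over `(0, r)` is at most the full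
integral. -/
theorem pow_mul_sqrt_le (hn : 3 ≤ n) (hφ : Antitone φ)
    (hint : IntegrableOn (fun r : ℝ => r ^ (n - 2) * √(φ r)) (Set.Ioi 0)) {r : ℝ} (hr : 0 < r) :
    r ^ (n - 1) * √(φ r) ≤ (n - 1 : ℕ) * ∫ s in Set.Ioi (0 : ℝ), s ^ (n - 2) * √(φ s) := by
  have h1 : ∫ s in (0 : ℝ)..r, s ^ (n - 2) * √(φ r) = r ^ (n - 1) / (n - 1 : ℕ) * √(φ r) := by
    rw [intervalIntegral.integral_mul_const, integral_pow]
    have : n - 2 + 1 = n - 1 := by omega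
    rw [this, zero_pow (by omega), sub_zero, ← this]
    push_cast
    rfl
  have h2 : ∫ s in (0 : ℝ)..r, s ^ (n - 2) * √(φ r) ≤
      ∫ s in Set.Ioi (0 : ℝ), s ^ (n - 2) * √(φ s) := by
    rw [intervalIntegral.integral_of_le hr.le]
    calc _ ≤ ∫ s in Set.Ioc 0 r, s ^ (n - 2) * √(φ s) := by
          refine setIntegral_mono_on ?_ (hint.mono_set Set.Ioc_subset_Ioi_self)
            measurableSet_Ioc fun s hs => ?_
          · exact (by fun_prop : Continuous fun s : ℝ => s ^ (n - 2) * √(φ r)).integrableOn_Ioc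
          · have := hs.1.le
            gcongr
            exact hφ hs.2
      _ ≤ _ := by
          refine setIntegral_mono_set hint ?_ Set.Ioc_subset_Ioi_self.eventuallyLE
          filter_upwards [ae_restrict_mem measurableSet_Ioi] with s hs
          have hs : 0 < s := hs
          simp only [Pi.zero_apply]
          positivity
  have h3 : (0 : ℝ) < (n - 1 : ℕ) := by
    exact_mod_cast (by omega : 0 < n - 1)
  rw [h1, div_mul_eq_mul_div, div_le_iff₀ h3] at h2
  linarith

/-- Write `φ = √φ * √φ`: one factor absorbs `r ^ (n - 1)`, the other is integrable. -/
theorem integrableOn_pow_mul (hn : 3 ≤ n) (hφ : Antitone φ) (h0 : ∀ r, 0 ≤ φ r)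
    (h1 : ∀ r, φ r ≤ 1)
    (hint : IntegrableOn (fun r : ℝ => r ^ (n - 2) * √(φ r)) (Set.Ioi 0)) :
    IntegrableOn (fun r : ℝ => r ^ (n - 1) * φ r) (Set.Ioi 0) := by
  have h := integrableOn_pow_mul_sqrt hφ h1 hint (Nat.zero_le _)
  refine Integrable.mono' (h.const_mul ((n - 1 : ℕ) * ∫ s in Set.Ioi (0 : ℝ),
    s ^ (n - 2) * √(φ s))) ?_ ?_
  · exact ((measurable_id.pow_const _).mul hφ.measurable).aestronglyMeasurable
  · filter_upwards [ae_restrict_mem measurableSet_Ioi] with r hr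
    have hr : 0 < r := hr
    have := h0 r
    rw [Real.norm_of_nonneg (by positivity), pow_zero, one_mul]
    calc r ^ (n - 1) * φ r = r ^ (n - 1) * √(φ r) * √(φ r) := by
          rw [mul_assoc, Real.mul_self_sqrt this]
      _ ≤ _ := mul_le_mul_of_nonneg_right (pow_mul_sqrt_le hn hφ hint hr) (Real.sqrt_nonneg _)

theorem integrableOn_pow_mul_comp_half {g : ℝ → ℝ} {k : ℕ}
    (h : IntegrableOn (fun r : ℝ => r ^ k * g r) (Set.Ioi 0)) :
    IntegrableOn (fun r : ℝ => r ^ k * g (r / 2)) (Set.Ioi 0) := by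
  have h2 := (integrableOn_Ioi_comp_mul_left_iff (fun r : ℝ => r ^ k * g r) 0
    (by norm_num : (0 : ℝ) < 1 / 2)).2 (by simpa using h)
  refine (h2.const_mul (2 ^ k)).congr (ae_of_all _ fun r => ?_)
  simp only [mul_pow, one_div]
  rw [← mul_assoc, ← mul_assoc, ← mul_pow]
  simp [div_eq_inv_mul]

theorem integrable_comp_norm_half (hn : 3 ≤ n) (hφ : Antitone φ) (h0 : ∀ r, 0 ≤ φ r)
    (h1 : ∀ r, φ r ≤ 1)
    (hint : IntegrableOn (fun r : ℝ => r ^ (n - 2) * √(φ r)) (Set.Ioi 0)) :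
    Integrable (fun x : E n => φ (‖x‖ / 2)) := by
  have : Nonempty (Fin n) := ⟨⟨0, by omega⟩⟩
  refine (integrable_fun_norm_addHaar volume (f := fun r => φ (r / 2))).2 ?_
  simp only [finrank_euclideanSpace, Fintype.card_fin, smul_eq_mul]
  exact integrableOn_pow_mul_comp_half (integrableOn_pow_mul hn hφ h0 h1 hint)

theorem integrable_sqrt_comp_norm_half_mul (hn : 3 ≤ n) (hφ : Antitone φ)
    (h1 : ∀ r, φ r ≤ 1)
    (hint : IntegrableOn (fun r : ℝ => r ^ (n - 2) * √(φ r)) (Set.Ioi 0)) :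
    Integrable (fun x : E n => √(φ (‖x‖ / 2)) * (‖x‖ ^ (n - 2))⁻¹) := by
  have : Nonempty (Fin n) := ⟨⟨0, by omega⟩⟩
  refine (integrable_fun_norm_addHaar volume
    (f := fun r => √(φ (r / 2)) * (r ^ (n - 2))⁻¹)).2 ?_
  simp only [finrank_euclideanSpace, Fintype.card_fin, smul_eq_mul]
  -- The Jacobian `r ^ (n - 1)` against `r ^ (n - 2)` leaves the first power of `r`, and `1 ≤ n - 2`
  -- because `3 ≤ n`.
  refine (integrableOn_pow_mul_comp_half (g := fun r => √(φ r)) (k := 1)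
    (integrableOn_pow_mul_sqrt hφ h1 hint (by omega))).congr ?_
  filter_upwards [ae_restrict_mem measurableSet_Ioi] with r hr
  have hr : r ≠ 0 := (Set.mem_Ioi.1 hr).ne'
  have : n - 1 = n - 2 + 1 := by omega
  rw [this]
  field_simp
  ring

end Radial

/-! ### Square integrability of the covariance. -/

section CovL2

variable {n : ℕ} {Ω : Type*} [MeasurableSpace Ω] {P : Measure Ω} {Y : Fin 2 → Ω → E n → ℝ}
  [IsProbabilityMeasure P]

theorem memLp_two_cov (hn : 3 ≤ n) (hY : IsRandomState P Y) {e₀ : ℝ≥0} (hz : ZeroMean P Y)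
    (he : HasMeanEnergyDensity P Y e₀) {q : Fin 2 → Fin 2 → E n → ℝ} (hq : HasCovariance P Y q)
    (hmix : IsMixing P Y) (i j : Fin 2) : MemLp (q i j) 2 volume := by
  have hm := (hY.isField he i).aesm_cov (hY.isField he j) (hq i j)
  rw [memLp_two_iff_integrable_sq hm]
  refine Integrable.mono' ((integrable_comp_norm_half hn (mixingCoeff_antitone P Y)
    (mixingCoeff_nonneg P Y) (mixingCoeff_le_one P Y) hmix.2).const_mul ((2 * e₀) ^ 2))
    (hm.pow 2) ?_
  filter_upwards [ae_abs_cov_le_mixing (by omega) hY hz he hq i j] with x hx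
  have h := pow_le_pow_left₀ (abs_nonneg _) hx 2
  rw [mul_pow, Real.sq_sqrt (mixingCoeff_nonneg P Y _), sq_abs] at h
  rwa [norm_pow, Real.norm_eq_abs, sq_abs]

end CovL2

open FourierTransform

/-! ### The spectral density and Fourier transforms of test functions. -/

section FourierPair

variable {n : ℕ}

/-- `f` is the inverse Fourier transform (in Mathlib's normalization) of the square integrable
function `q`. -/
def IsInvFourier (q : E n → ℝ) (f : E n → ℂ) : Prop :=
  MemLp f 2 volume ∧ ∀ ψ : 𝓢(E n, ℂ), ∫ k, f k * ψ k = ∫ x, (q x : ℂ) * (𝓕⁻ ψ) x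

theorem exists_isInvFourier {q : E n → ℝ} (hq : MemLp q 2 volume) :
    ∃ f : E n → ℂ, IsInvFourier q f := by
  have hqc : MemLp (fun x => (q x : ℂ)) 2 volume := hq.ofReal
  set Q : Lp ℂ 2 (volume : Measure (E n)) := hqc.toLp _ with hQ
  refine ⟨(𝓕⁻ Q : Lp ℂ 2 (volume : Measure (E n))), Lp.memLp _, fun ψ => ?_⟩
  have h := congrArg (fun T : 𝓢'(E n, ℂ) => T ψ) (Lp.fourierInv_toTemperedDistribution_eq Q)
  simp only [TemperedDistribution.fourierInv_apply, Lp.toTemperedDistribution_apply,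
    smul_eq_mul] at h
  calc _ = ∫ x, ψ x * (𝓕⁻ Q : Lp ℂ 2 (volume : Measure (E n))) x := by simp_rw [mul_comm]
    _ = ∫ x, (𝓕⁻ ψ) x * Q x := h.symm
    _ = _ := by
      refine integral_congr_ae ?_
      filter_upwards [hqc.coeFn_toLp] with x hx
      rw [hQ, hx, mul_comm]

/-- The covariance form in terms of the Fourier transform. -/
theorem IsInvFourier.integral_sub_mul {q : E n → ℝ} {f : E n → ℂ} (h : IsInvFourier q f)
    (hm : AEStronglyMeasurable q volume) {K : ℝ} (hK : ∀ᵐ x, |q x| ≤ K) (a b : 𝓢(E n, ℂ)) :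
    ∫ z : E n × E n, (q (z.1 - z.2) : ℂ) * (a z.1 * b (-z.2)) =
      ∫ k, f k * ((𝓕 a) k * (𝓕 b) k) := by
  set B := ContinuousLinearMap.mul ℂ ℂ
  -- The product of transforms is the transform of a convolution, so testing `f` with it returns the
  -- convolution itself against `q`.
  have h1 : ∫ k, f k * ((𝓕 a) k * (𝓕 b) k) = ∫ x, (q x : ℂ) * SchwartzMap.convolution B b a x := by
    have := h.2 (𝓕 (SchwartzMap.convolution B b a))
    rw [FourierTransform.fourierInv_fourier_eq, SchwartzMap.fourier_convolution] at this
    rw [← this]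
    refine integral_congr_ae (ae_of_all _ fun k => ?_)
    simp [B, mul_comm]
  have hb : Integrable (fun y => b (-y)) := b.integrable.comp_neg
  have hint := integrable_bdd_sub_mul hm hK (a.integrable.mul_prod hb)
  have hmp := measurePreserving_add_prod (volume : Measure (E n)) (volume : Measure (E n))
  have hint2 := hmp.integrable_comp_of_integrable hint
  rw [h1, Measure.volume_eq_prod]
  calc _ = ∫ z : E n × E n, (q z.1 : ℂ) * (a (z.1 + z.2) * b (-z.2)) ∂(volume.prod volume) := by
        rw [← hmp.map_eq] at hint
        conv_lhs => rw [← hmp.map_eq]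
        rw [integral_map hmp.measurable.aemeasurable hint.1]
        simp
    _ = ∫ x, ∫ y, (q x : ℂ) * (a (x + y) * b (-y)) := by
        refine integral_prod _ ?_
        simpa [Function.comp_def] using hint2
    _ = _ := by
        refine integral_congr_ae (ae_of_all _ fun x => ?_)
        simp only
        rw [integral_const_mul, SchwartzMap.convolution_apply, convolution_def,
          ← integral_neg_eq_self]
        congr 1
        refine integral_congr_ae (ae_of_all _ fun y => ?_)
        simp [B, mul_comm, sub_eq_add_neg]

/-- A real test function as a complex Schwartz function. -/
def IsTest.toSchwartz {ψ : E n → ℝ} (h : IsTest ψ) : 𝓢(E n, ℂ) :=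
  HasCompactSupport.toSchwartzMap (f := fun x => (ψ x : ℂ))
    (h.2.comp_left (g := fun x : ℝ => (x : ℂ)) Complex.ofReal_zero)
    (Complex.ofRealCLM.contDiff.comp h.1)

@[simp] theorem IsTest.toSchwartz_apply {ψ : E n → ℝ} (h : IsTest ψ) (x : E n) :
    h.toSchwartz x = (ψ x : ℂ) := rfl

theorem IsTest.conj_fourierInv {ψ : E n → ℝ} (h : IsTest ψ) (x : E n) :
    starRingEnd ℂ ((𝓕⁻ h.toSchwartz) x) = (𝓕⁻ h.toSchwartz) (-x) := by
  rw [SchwartzMap.fourierInv_coe, Real.fourierInv_eq', Real.fourierInv_eq', ← integral_conj]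
  refine integral_congr_ae (ae_of_all _ fun y => ?_)
  simp only [smul_eq_mul, IsTest.toSchwartz_apply, map_mul, Complex.conj_ofReal,
    ← Complex.exp_conj, Complex.conj_I, inner_neg_right]
  congr 2
  push_cast
  ring

theorem fourier_apply_eq_fourierInv_neg (a : 𝓢(E n, ℂ)) (k : E n) : (𝓕 a) k = (𝓕⁻ a) (-k) := by
  rw [SchwartzMap.fourierInv_coe, Real.fourierInv_eq_fourier_neg, neg_neg]
  rfl

theorem IsTest.conj_fourier_of_even {ψ : E n → ℝ} (h : IsTest ψ) (he : ∀ x, ψ (-x) = ψ x)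
    (k : E n) : starRingEnd ℂ ((𝓕 h.toSchwartz) k) = (𝓕 h.toSchwartz) k := by
  rw [fourier_apply_eq_fourierInv_neg, h.conj_fourierInv, neg_neg, SchwartzMap.fourierInv_coe,
    Real.fourierInv_eq_fourier_neg _ (-k), neg_neg, Real.fourierInv_eq_fourier_comp_neg]
  simp only [IsTest.toSchwartz_apply, he]
  rfl

theorem mollifier_neg (n k : ℕ) (x : E n) : mollifier n k (-x) = mollifier n k x :=
  (bump n k).normed_neg x

/-- The transform at `ξ` is the mollification at `0` of a continuous character, whose value there is
`1`. -/
theorem tendsto_fourier_mollifier (ξ : E n) :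
    Tendsto (fun k => (𝓕 (isTest_mollifier n k).toSchwartz) ξ) atTop (𝓝 1) := by
  have hc : Continuous fun x : E n => Complex.exp (((2 * Real.pi * inner ℝ x ξ : ℝ) : ℂ) * Complex.I) := by
    fun_prop
  have h := ContDiffBump.convolution_tendsto_right_of_continuous (μ := volume)
    (tendsto_rOut_bump n) hc 0
  simp only [inner_zero_left, mul_zero, Complex.ofReal_zero, zero_mul, Complex.exp_zero] at h
  refine h.congr fun k => ?_
  rw [fourier_apply_eq_fourierInv_neg, SchwartzMap.fourierInv_coe, Real.fourierInv_eq',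
    convolution_def]
  refine integral_congr_ae (ae_of_all _ fun x => ?_)
  simp [mollifier, mul_comm]

/-- Bounds against all squared Fourier transforms of mollifiers pass to the limit. -/
theorem lintegral_le_of_forall_mollifier {g : E n → ℝ≥0∞} (hg : AEMeasurable g volume) {M : ℝ≥0∞}
    (h : ∀ k, ∫⁻ ξ, g ξ * ‖(𝓕 (isTest_mollifier n k).toSchwartz) ξ‖ₑ ^ 2 ≤ M) :
    ∫⁻ ξ, g ξ ≤ M := by
  set F : ℕ → E n → ℂ := fun k ξ => (𝓕 (isTest_mollifier n k).toSchwartz) ξ with hF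
  have hFm : ∀ k, Measurable (F k) := fun k =>
    (𝓕 (isTest_mollifier n k).toSchwartz).continuous.measurable
  have hFt : ∀ ξ, Tendsto (fun k => F k ξ) atTop (𝓝 1) := tendsto_fourier_mollifier
  replace h : ∀ k, ∫⁻ ξ, g ξ * ‖F k ξ‖ₑ ^ 2 ≤ M := h
  clear_value F
  calc ∫⁻ ξ, g ξ ≤ ∫⁻ ξ, liminf (fun k => g ξ * ‖F k ξ‖ₑ ^ 2) atTop := by
        refine lintegral_mono fun ξ => ?_
        have h1 : Tendsto (fun k => g ξ * ‖F k ξ‖ₑ ^ 2) atTop (𝓝 (g ξ * ‖(1 : ℂ)‖ₑ ^ 2)) :=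
          ENNReal.Tendsto.const_mul (((ENNReal.continuous_pow 2).tendsto _).comp
            (hFt ξ).enorm) (by simp)
        rw [h1.liminf_eq]
        simp
    _ ≤ liminf (fun k => ∫⁻ ξ, g ξ * ‖F k ξ‖ₑ ^ 2) atTop :=
        lintegral_liminf_le' fun k => hg.mul ((hFm k).enorm.pow_const 2).aemeasurable
    _ ≤ M := by
        refine liminf_le_of_le (by isBoundedDefault) fun b hb => ?_
        obtain ⟨k, hk⟩ := hb.exists
        exact hk.trans (h k)

end FourierPair

open scoped ComplexOrder

/-! ### Positivity of the spectral matrix and domination by its diagonal. -/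

section Positivity

variable {n : ℕ} {Ω : Type*} [MeasurableSpace Ω] {P : Measure Ω} {Y : Fin 2 → Ω → E n → ℝ}
  [IsProbabilityMeasure P]

omit [MeasurableSpace Ω] in
theorem conj_smear (X : Ω → E n → ℝ) (ψ : E n → ℂ) (ω : Ω) :
    starRingEnd ℂ (smear X ψ ω) = smear X (fun x => starRingEnd ℂ (ψ x)) ω := by
  rw [smear, smear, ← integral_conj]
  simp

/-- The quadratic form of the spectral matrix is nonnegative on test functions. -/
theorem integral_spectral_mul_sq_nonneg {X : Fin 2 → Ω → E n → ℝ} {M : ℝ≥0}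
    (hX : ∀ i, IsField P (X i) M) {q : Fin 2 → Fin 2 → E n → ℝ} (hq : HasCovariance P X q)
    {f : Fin 2 → Fin 2 → E n → ℂ} (hf : ∀ i j, IsInvFourier (q i j) (f i j)) (c : Fin 2 → ℂ)
    {χ : E n → ℝ} (hχ : IsTest χ) :
    0 ≤ ∫ k, (∑ i, ∑ j, c i * starRingEnd ℂ (c j) * f i j k) * (χ k : ℂ) ^ 2 := by
  -- With `𝓕 a = χ` real, conjugation of `a` is reflection. The form thus becomes the expectation of
  -- the squared modulus of `∑ i, c i * smear (X i) a`.
  set a := 𝓕⁻ hχ.toSchwartz with ha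
  have hconj : ∀ y, starRingEnd ℂ (a y) = a (-y) := hχ.conj_fourierInv
  have hFa : 𝓕 a = hχ.toSchwartz := FourierTransform.fourier_fourierInv_eq _
  have haneg : Integrable (fun y => a (-y)) := a.integrable.comp_neg
  have hij : ∀ i j, ∫ ω, smear (X i) a ω * smear (X j) (fun y => a (-y)) ω ∂P =
      ∫ k, f i j k * (χ k : ℂ) ^ 2 := by
    intro i j
    rw [(hX i).integral_smear_mul_smear (hX j) (hq i j) a.integrable haneg,
      (hf i j).integral_sub_mul ((hX i).aesm_cov (hX j) (hq i j))
        ((hX i).ae_abs_cov_le (hX j) (hq i j)) a a, hFa]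
    simp [pow_two]
  have hint1 : ∀ i j, Integrable (fun ω => smear (X i) a ω * smear (X j) (fun y => a (-y)) ω) P :=
    fun i j => ((hX i).memLp_smear a.integrable).integrable_mul ((hX j).memLp_smear haneg)
  have hint2 : ∀ i j, Integrable (fun k => f i j k * (χ k : ℂ) ^ 2) := by
    intro i j
    have h2 : MemLp (fun k => (χ k : ℂ) ^ 2) 2 volume := by
      refine Continuous.memLp_of_hasCompactSupport
        ((Complex.continuous_ofReal.comp hχ.1.continuous).pow 2) ?_
      exact hχ.2.comp_left (g := fun x : ℝ => (x : ℂ) ^ 2) (by simp)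
    exact (hf i j).1.integrable_mul h2
  have key : ∫ k, (∑ i, ∑ j, c i * starRingEnd ℂ (c j) * f i j k) * (χ k : ℂ) ^ 2 =
      ∫ ω, (∑ i, c i * smear (X i) a ω) * starRingEnd ℂ (∑ i, c i * smear (X i) a ω) ∂P := by
    calc _ = ∑ i, ∑ j, c i * starRingEnd ℂ (c j) * ∫ k, f i j k * (χ k : ℂ) ^ 2 := by
          simp_rw [Finset.sum_mul, mul_assoc (c _ * _)]
          rw [integral_finsetSum _ fun i _ => integrable_finsetSum _ fun j _ =>
            (hint2 i j).const_mul _]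
          refine Finset.sum_congr rfl fun i _ => ?_
          rw [integral_finsetSum _ fun j _ => (hint2 i j).const_mul _]
          exact Finset.sum_congr rfl fun j _ => integral_const_mul _ _
      _ = ∑ i, ∑ j, ∫ ω, c i * starRingEnd ℂ (c j) *
            (smear (X i) a ω * smear (X j) (fun y => a (-y)) ω) ∂P := by
          simp_rw [← hij, integral_const_mul]
      _ = _ := by
          simp_rw [← integral_finsetSum _ fun j _ => (hint1 _ j).const_mul _]
          rw [← integral_finsetSum _ fun i _ => integrable_finsetSum _ fun j _ =>
            (hint1 i j).const_mul _]
          refine integral_congr_ae (ae_of_all _ fun ω => ?_)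
          simp only [map_sum, map_mul, conj_smear, hconj, Finset.sum_mul_sum]
          refine Finset.sum_congr rfl fun i _ => Finset.sum_congr rfl fun j _ => ?_
          ring
  rw [key]
  simp_rw [Complex.mul_conj]
  rw [integral_complex_ofReal]
  exact_mod_cast integral_nonneg fun ω => Complex.normSq_nonneg _

/-- Squares of bumps decrease to the indicator of a closed ball, so averages over balls are
nonnegative; Lebesgue differentiation concludes. Squares appear because a quadratic form tests only
against them. -/
theorem nonneg_of_forall_test {F : E n → ℂ} (hF : LocallyIntegrable F volume)
    (h : ∀ χ : E n → ℝ, IsTest χ → 0 ≤ ∫ k, F k * (χ k : ℂ) ^ 2) : ∀ᵐ k, 0 ≤ F k := by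
  have hclosed : IsClosed {z : ℂ | 0 ≤ z} := isClosed_Ici
  have hball : ∀ (x : E n) (r : ℝ), 0 < r → 0 ≤ ∫ k in Metric.closedBall x r, F k := by
    intro x r hr
    let χ : ℕ → ContDiffBump x := fun m =>
      ⟨r, r + 1 / ((m : ℝ) + 1), hr, by
        have : (0 : ℝ) < 1 / ((m : ℝ) + 1) := by positivity
        linarith⟩
    have hχ : ∀ m, IsTest (χ m) := fun m => ⟨(χ m).contDiff, (χ m).hasCompactSupport⟩
    have hlim : Tendsto (fun m => ∫ k, F k * (χ m k : ℂ) ^ 2) atTop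
        (𝓝 (∫ k, (Metric.closedBall x r).indicator F k)) := by
      refine tendsto_integral_of_dominated_convergence
        (fun k => ‖(Metric.closedBall x (r + 1)).indicator F k‖) (fun m => ?_) ?_
        (fun m => ae_of_all _ fun k => ?_) (ae_of_all _ fun k => ?_)
      · exact hF.aestronglyMeasurable.mul
          ((Complex.continuous_ofReal.comp (χ m).continuous).pow 2).aestronglyMeasurable
      · exact ((integrable_indicator_iff Metric.isClosed_closedBall.measurableSet).2
          (hF.integrableOn_isCompact (isCompact_closedBall _ _))).norm
      · by_cases hk : k ∈ Metric.closedBall x (r + 1)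
        · rw [Set.indicator_of_mem hk, norm_mul]
          refine mul_le_of_le_one_right (norm_nonneg _) ?_
          rw [norm_pow, Complex.norm_real, Real.norm_of_nonneg (χ m).nonneg]
          exact pow_le_one₀ (χ m).nonneg (χ m).le_one
        · rw [(χ m).zero_of_le_dist]
          · simp
          · have h1 : 1 / ((m : ℝ) + 1) ≤ 1 := by
              rw [div_le_one (by positivity)]
              linarith [(Nat.cast_nonneg m : (0 : ℝ) ≤ m)]
            have h2 := not_le.1 fun h => hk (Metric.mem_closedBall.2 h)
            change r + 1 / ((m : ℝ) + 1) ≤ dist k x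
            linarith
      · by_cases hk : k ∈ Metric.closedBall x r
        · rw [Set.indicator_of_mem hk]
          refine tendsto_const_nhds.congr fun m => ?_
          rw [(χ m).one_of_mem_closedBall hk]
          simp
        · rw [Set.indicator_of_notMem hk]
          have h2 : 0 < dist k x - r := sub_pos.2 (not_le.1 hk)
          refine tendsto_const_nhds.congr' ?_
          filter_upwards [(tendsto_one_div_add_atTop_nhds_zero_nat (𝕜 := ℝ)).eventually_lt_const
            h2] with m hm
          rw [(χ m).zero_of_le_dist]
          · simp
          · change r + 1 / ((m : ℝ) + 1) ≤ dist k x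
            linarith
    rw [integral_indicator Metric.isClosed_closedBall.measurableSet] at hlim
    exact hclosed.mem_of_tendsto hlim (Eventually.of_forall fun m => h _ (hχ m))
  filter_upwards [IsUnifLocDoublingMeasure.ae_tendsto_average volume hF 1] with x hx
  have hδ : Tendsto (fun m : ℕ => 1 / ((m : ℝ) + 1)) atTop (𝓝[>] 0) :=
    tendsto_nhdsWithin_iff.2 ⟨tendsto_one_div_add_atTop_nhds_zero_nat,
      Eventually.of_forall fun m => by simp only [Set.mem_Ioi]; positivity⟩
  have := hx (fun _ : ℕ => x) (fun m => 1 / ((m : ℝ) + 1)) hδ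
    (Eventually.of_forall fun m => Metric.mem_closedBall_self (by positivity))
  refine hclosed.mem_of_tendsto this (Eventually.of_forall fun m => ?_)
  rw [setAverage_eq, Set.mem_ofPred_eq, Complex.real_smul]
  refine mul_nonneg ?_ (hball x _ (by positivity))
  exact_mod_cast inv_nonneg.2 measureReal_nonneg

/-- The spectral matrix is almost everywhere positive semidefinite. -/
theorem ae_spectral_nonneg {X : Fin 2 → Ω → E n → ℝ} {M : ℝ≥0}
    (hX : ∀ i, IsField P (X i) M) {q : Fin 2 → Fin 2 → E n → ℝ} (hq : HasCovariance P X q)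
    {f : Fin 2 → Fin 2 → E n → ℂ} (hf : ∀ i j, IsInvFourier (q i j) (f i j)) :
    ∀ᵐ k, ∀ c : Fin 2 → ℂ, 0 ≤ ∑ i, ∑ j, c i * starRingEnd ℂ (c j) * f i j k := by
  -- A countable dense set of `c` allows one null set for all `c`; continuity in `c` does the rest.
  obtain ⟨D, hDc, hDd⟩ := TopologicalSpace.exists_countable_dense (Fin 2 → ℂ)
  have h1 : ∀ c : Fin 2 → ℂ, ∀ᵐ k, 0 ≤ ∑ i, ∑ j, c i * starRingEnd ℂ (c j) * f i j k := by
    intro c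
    refine nonneg_of_forall_test ?_ fun χ hχ => integral_spectral_mul_sq_nonneg hX hq hf c hχ
    have : MemLp (fun k => ∑ i, ∑ j, c i * starRingEnd ℂ (c j) * f i j k) 2 volume :=
      memLp_finsetSum _ fun i _ => memLp_finsetSum _ fun j _ => (hf i j).1.const_mul _
    exact this.locallyIntegrable one_le_two
  have h2 : ∀ᵐ k, ∀ c ∈ D, 0 ≤ ∑ i, ∑ j, c i * starRingEnd ℂ (c j) * f i j k :=
    (ae_ball_iff hDc).2 fun c _ => h1 c
  filter_upwards [h2] with k hk c
  have hcl : IsClosed {c : Fin 2 → ℂ | 0 ≤ ∑ i, ∑ j, c i * starRingEnd ℂ (c j) * f i j k} :=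
    isClosed_le continuous_const <| continuous_finsetSum _ fun i _ => continuous_finsetSum _ fun j _ =>
      ((continuous_apply i).mul (Complex.continuous_conj.comp (continuous_apply j))).mul
        continuous_const
  exact hcl.closure_subset_iff.2 hk (hDd c)

theorem diag_nonneg_of_form_nonneg {A : Fin 2 → Fin 2 → ℂ}
    (h : ∀ c : Fin 2 → ℂ, 0 ≤ ∑ i, ∑ j, c i * starRingEnd ℂ (c j) * A i j) (i : Fin 2) :
    0 ≤ A i i := by
  have := h (Pi.single i 1)
  fin_cases i <;> simpa [Fin.sum_univ_two] using this

/-- The form is evaluated at `(w, u)`, with `u` unimodular chosen so that the cross terms are real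
and equal to `-w ‖A 0 1‖`. The free weight `w` later becomes `2π‖k‖`. -/
theorem norm_offDiag_le_of_form_nonneg {A : Fin 2 → Fin 2 → ℂ}
    (h : ∀ c : Fin 2 → ℂ, 0 ≤ ∑ i, ∑ j, c i * starRingEnd ℂ (c j) * A i j) (w : ℝ) :
    2 * (w * ‖A 0 1‖) ≤ w ^ 2 * ‖A 0 0‖ + ‖A 1 1‖ ∧ ‖A 1 0‖ = ‖A 0 1‖ := by
  have a0 := diag_nonneg_of_form_nonneg h 0
  have a1 := diag_nonneg_of_form_nonneg h 1
  have n0 : A 0 0 = (‖A 0 0‖ : ℂ) := (Complex.norm_of_nonneg' a0).symm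
  have n1 : A 1 1 = (‖A 1 1‖ : ℂ) := (Complex.norm_of_nonneg' a1).symm
  -- The vanishing imaginary parts at these two vectors make the matrix Hermitian.
  have e1 := h ![1, 1]
  have e2 := h ![1, Complex.I]
  simp only [Fin.sum_univ_two, Matrix.cons_val_zero, Matrix.cons_val_one, map_one, one_mul,
    mul_one, Complex.conj_I, Complex.le_def, Complex.add_re, Complex.add_im, Complex.mul_re,
    Complex.mul_im, Complex.neg_re, Complex.neg_im, Complex.I_re, Complex.I_im, Complex.zero_re,
    Complex.zero_im] at e1 e2 a0 a1
  have hC : A 1 0 = starRingEnd ℂ (A 0 1) := by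
    apply Complex.ext
    · rw [Complex.conj_re]; linarith [e2.2]
    · rw [Complex.conj_im]; linarith [e1.2]
  refine ⟨?_, by rw [hC, Complex.norm_conj]⟩
  obtain ⟨u, hu, hu1⟩ : ∃ u : ℂ, starRingEnd ℂ u * A 0 1 = -(‖A 0 1‖ : ℂ) ∧
      starRingEnd ℂ u * u = 1 := by
    by_cases hB : A 0 1 = 0
    · exact ⟨1, by simp [hB], by simp⟩
    · have hB' : (‖A 0 1‖ : ℂ) ≠ 0 := by simpa using hB
      refine ⟨-(A 0 1 / ‖A 0 1‖), ?_, ?_⟩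
      · rw [map_neg, map_div₀, Complex.conj_ofReal, neg_mul, div_mul_eq_mul_div,
          Complex.conj_mul', pow_two, mul_div_assoc, div_self hB', mul_one]
      · rw [map_neg, map_div₀, Complex.conj_ofReal, neg_mul_neg, div_mul_div_comm,
          Complex.conj_mul', pow_two, div_self (mul_ne_zero hB' hB')]
  have h3 := h ![(w : ℂ), u]
  have h4 : u * A 1 0 = -(‖A 0 1‖ : ℂ) := by
    have := congrArg (starRingEnd ℂ) hu
    simpa [hC] using this
  simp only [Fin.sum_univ_two, Matrix.cons_val_zero, Matrix.cons_val_one,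
    Complex.conj_ofReal] at h3
  have h5 : (w : ℂ) * w * A 0 0 + w * starRingEnd ℂ u * A 0 1 + (u * w * A 1 0 +
      u * starRingEnd ℂ u * A 1 1) = ((w ^ 2 * ‖A 0 0‖ + ‖A 1 1‖ - 2 * (w * ‖A 0 1‖) : ℝ) : ℂ) := by
    push_cast
    rw [← n0, ← n1]
    linear_combination (w : ℂ) * hu + w * h4 + A 1 1 * hu1
  rw [h5] at h3
  have : 0 ≤ w ^ 2 * ‖A 0 0‖ + ‖A 1 1‖ - 2 * (w * ‖A 0 1‖) := by exact_mod_cast h3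
  linarith

end Positivity

open scoped LineDeriv

/-! ### Mass and second moment of the spectral densities. -/

section Moments

variable {n : ℕ} {Ω : Type*} [MeasurableSpace Ω] {P : Measure Ω} {Y : Fin 2 → Ω → E n → ℝ}
  [IsProbabilityMeasure P]

theorem lintegral_enorm_le_of_integral_le {F : E n → ℂ} (hF : Integrable F) (h0 : ∀ᵐ k, 0 ≤ F k)
    {t : ℝ} {M : ℝ≥0} (ht : ∫ k, F k = t) (htM : t ≤ M) : ∫⁻ k, ‖F k‖ₑ ≤ M := by
  have h1 : ∫ k, ‖F k‖ = t := by
    apply Complex.ofReal_injective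
    rw [← ht, ← integral_complex_ofReal]
    refine integral_congr_ae ?_
    filter_upwards [h0] with k hk using Complex.norm_of_nonneg' hk
  rw [← ofReal_integral_norm_eq_lintegral_enorm hF, h1]
  exact ENNReal.ofReal_le_of_le_toReal (by simpa using htM)

/-- The quadratic form of a field on a real test function with a parity. -/
theorem integral_mul_fourier_sq {X : Ω → E n → ℝ} {M : ℝ≥0} (hX : IsField P X M) {q : E n → ℝ}
    (hq : ∀ᵐ z : E n × E n, ∫ ω, X ω z.1 * X ω z.2 ∂P = q (z.1 - z.2)) {f : E n → ℂ}
    (hf : IsInvFourier q f) {ψ : E n → ℝ} (hψ : IsTest ψ) {σ : ℝ} (hσ : ∀ x, ψ (-x) = σ * ψ x) :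
    ∫ k, f k * (𝓕 hψ.toSchwartz) k ^ 2 = ((σ * ∫ ω, (∫ x, X ω x * ψ x) ^ 2 ∂P : ℝ) : ℂ) := by
  have h1 := hf.integral_sub_mul (hX.aesm_cov hX hq) (hX.ae_abs_cov_le hX hq)
    hψ.toSchwartz hψ.toSchwartz
  simp only [← pow_two] at h1
  rw [← h1]
  simp only [pow_two]
  rw [hX.integral_mul_mul hX hq hψ.integrable hψ.integrable, ← integral_const_mul,
    ← integral_complex_ofReal]
  refine integral_congr_ae (ae_of_all _ fun z => ?_)
  simp only [IsTest.toSchwartz_apply, hσ]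
  push_cast
  ring

theorem integrable_mul_fourier_sq {f : E n → ℂ} (hf : MemLp f 2 volume) (a : 𝓢(E n, ℂ)) :
    Integrable (fun k => f k * (𝓕 a) k ^ 2) := by
  have h1 : MemLp (fun k => f k * (𝓕 a) k) 2 volume :=
    ((𝓕 a).memLp_top).mul hf
  have h2 := h1.integrable_mul ((𝓕 a).memLp 2)
  refine h2.congr (ae_of_all _ fun k => ?_)
  simp only [Pi.mul_apply]
  ring

/-- The mollifier is real and even, so its transform is real and the square is nonnegative. -/
theorem fourier_mollifier_sq (n k : ℕ) (ξ : E n) :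
    (𝓕 (isTest_mollifier n k).toSchwartz) ξ ^ 2 =
      ((‖(𝓕 (isTest_mollifier n k).toSchwartz) ξ‖ ^ 2 : ℝ) : ℂ) := by
  have h := (isTest_mollifier n k).conj_fourier_of_even (mollifier_neg n k) ξ
  rw [← Complex.normSq_eq_norm_sq, ← Complex.mul_conj, h, pow_two]

/-- The total mass of the spectral density is bounded by the second moment. -/
theorem lintegral_spectral_le {X : Ω → E n → ℝ} {M : ℝ≥0} (hX : IsField P X M) {q : E n → ℝ}
    (hq : ∀ᵐ z : E n × E n, ∫ ω, X ω z.1 * X ω z.2 ∂P = q (z.1 - z.2)) {f : E n → ℂ}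
    (hf : IsInvFourier q f) (h0 : ∀ᵐ k, 0 ≤ f k) : ∫⁻ k, ‖f k‖ₑ ≤ M := by
  refine lintegral_le_of_forall_mollifier hf.1.1.enorm fun m => ?_
  have hψ := isTest_mollifier n m
  have h1 := integral_mul_fourier_sq hX hq hf hψ (σ := 1)
    (fun x => by rw [mollifier_neg, one_mul])
  rw [one_mul] at h1
  refine le_trans (le_of_eq (lintegral_congr fun k => ?_))
    (lintegral_enorm_le_of_integral_le (integrable_mul_fourier_sq hf.1 hψ.toSchwartz) ?_ h1
      (hX.integral_sq_le hψ.integrable (mollifier_nonneg n m) (integral_mollifier n m)))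
  · rw [enorm_mul, enorm_pow]
  · filter_upwards [h0] with k hk
    rw [fourier_mollifier_sq]
    exact mul_nonneg hk (Complex.zero_le_real.2 (sq_nonneg _))

theorem IsTest.fderiv_apply {ψ : E n → ℝ} (h : IsTest ψ) (w : E n) :
    IsTest (fun x => fderiv ℝ ψ x w) :=
  ⟨(h.1.fderiv_right (m := ((⊤ : ℕ∞) : WithTop ℕ∞)) le_rfl).clm_apply contDiff_const,
    h.2.fderiv_apply (𝕜 := ℝ) w⟩

theorem IsTest.fourier_fderiv {ψ : E n → ℝ} (h : IsTest ψ) (w k : E n) :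
    (𝓕 (h.fderiv_apply w).toSchwartz) k =
      2 * Real.pi * Complex.I * (inner ℝ k w : ℝ) * (𝓕 h.toSchwartz) k := by
  have e : (h.fderiv_apply w).toSchwartz = ∂_{w} h.toSchwartz := by
    ext x
    rw [SchwartzMap.lineDerivOp_apply_eq_fderiv]
    have hd : DifferentiableAt ℝ ψ x := (h.1.differentiable (by simp)) x
    have := (Complex.ofRealCLM.hasFDerivAt.comp x hd.hasFDerivAt).fderiv
    have h2 : fderiv ℝ (h.toSchwartz) x = Complex.ofRealCLM.comp (fderiv ℝ ψ x) := this
    rw [h2]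
    simp
  rw [e, SchwartzMap.fourier_lineDerivOp_eq]
  have hg : (fun x : E n => (inner ℝ x w : ℝ)).HasTemperateGrowth :=
    ((innerSL ℝ).flip w).hasTemperateGrowth
  simp [SchwartzMap.smulLeftCLM_apply_apply hg, mul_assoc]

omit [IsProbabilityMeasure P] in
/-- The components of the gradient of a random state. -/
theorem isField_gradient {e₀ : ℝ≥0} {G : Ω → E n → E n}
    (hG : AEMeasurable (fun z : Ω × E n => G z.1 z.2) (P.prod volume))
    (he : ∀ᵐ x : E n, ∫⁻ ω, (‖Y 1 ω x‖ₑ ^ 2 + ‖G ω x‖ₑ ^ 2 + ‖Y 0 ω x‖ₑ ^ 2) ∂P = (e₀ : ℝ≥0∞))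
    {w : E n} (hw : ‖w‖ ≤ 1) : IsField P (fun ω x => inner ℝ (G ω x) w) e₀ := by
  refine ⟨(hG.aestronglyMeasurable).inner aestronglyMeasurable_const, ?_⟩
  filter_upwards [he] with x hx
  rw [← hx]
  refine lintegral_mono fun ω => ?_
  refine le_add_right (le_add_left ?_)
  gcongr
  rw [← ofReal_norm, ← ofReal_norm]
  refine ENNReal.ofReal_le_ofReal ((norm_inner_le_norm _ _).trans ?_)
  exact mul_le_of_le_one_right (norm_nonneg _) hw

theorem IsTest.fderiv_neg_of_even {ψ : E n → ℝ} (h : IsTest ψ) (he : ∀ x, ψ (-x) = ψ x)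
    (w x : E n) : fderiv ℝ ψ (-x) w = -1 * fderiv ℝ ψ x w := by
  have h1 : HasFDerivAt ψ (fderiv ℝ ψ (-x)) (-x) :=
    (h.1.differentiable (by simp) (-x)).hasFDerivAt
  have h2 : HasFDerivAt (fun y => ψ (-y)) ((fderiv ℝ ψ (-x)).comp (-ContinuousLinearMap.id ℝ _)) x :=
    h1.comp x (hasFDerivAt_id x).neg
  rw [funext he] at h2
  rw [h2.fderiv]
  simp

/-- The second moment of the spectral density of `u₀` in a given direction. -/
theorem lintegral_inner_sq_spectral_le (hY : IsRandomState P Y) {e₀ : ℝ≥0}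
    (he : HasMeanEnergyDensity P Y e₀) {q : Fin 2 → Fin 2 → E n → ℝ} (hq : HasCovariance P Y q)
    {f : E n → ℂ} (hf : IsInvFourier (q 0 0) f) (h0 : ∀ᵐ k, 0 ≤ f k) {w : E n} (hw : ‖w‖ ≤ 1) :
    ∫⁻ k, ENNReal.ofReal ((2 * Real.pi * inner ℝ k w) ^ 2) * ‖f k‖ₑ ≤ e₀ := by
  have hX := hY.isField he 0
  obtain ⟨G, hGm, hG, hGe⟩ := he
  have hXG := isField_gradient (Y := Y) hGm hGe hw
  have hmw : Measurable fun k : E n => ENNReal.ofReal ((2 * Real.pi * inner ℝ k w) ^ 2) := by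
    fun_prop
  refine lintegral_le_of_forall_mollifier (hmw.aemeasurable.mul hf.1.1.enorm) fun m => ?_
  have hψ := isTest_mollifier n m
  -- The derivative of an even mollifier is odd; the sign `σ = -1` cancels the square of the factor
  -- `i` in its transform.
  have h1 := integral_mul_fourier_sq hX (hq 0 0) hf (hψ.fderiv_apply w) (σ := -1)
    (fun x => hψ.fderiv_neg_of_even (mollifier_neg n m) w x)
  have h2 : ∫ ω, (∫ x, Y 0 ω x * fderiv ℝ (mollifier n m) x w) ^ 2 ∂P =
      ∫ ω, (∫ x, inner ℝ (G ω x) w * mollifier n m x) ^ 2 ∂P := by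
    refine integral_congr_ae ?_
    filter_upwards [hG] with ω hω
    rw [hω.2.2 _ hψ w, neg_sq]
  rw [h2] at h1
  have h3 : ∀ k, ((2 * Real.pi * inner ℝ k w : ℝ) : ℂ) ^ 2 * f k * (𝓕 hψ.toSchwartz) k ^ 2 =
      -(f k * (𝓕 (hψ.fderiv_apply w).toSchwartz) k ^ 2) := by
    intro k
    rw [hψ.fourier_fderiv]
    push_cast
    linear_combination (2 * Real.pi * inner ℝ k w : ℂ) ^ 2 * f k * (𝓕 hψ.toSchwartz) k ^ 2 *
      Complex.I_sq
  have hint : Integrable fun k =>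
      ((2 * Real.pi * inner ℝ k w : ℝ) : ℂ) ^ 2 * f k * (𝓕 hψ.toSchwartz) k ^ 2 := by
    simp_rw [h3]
    exact (integrable_mul_fourier_sq hf.1 _).neg
  have h4 : ∫ k, ((2 * Real.pi * inner ℝ k w : ℝ) : ℂ) ^ 2 * f k * (𝓕 hψ.toSchwartz) k ^ 2 =
      ((∫ ω, (∫ x, inner ℝ (G ω x) w * mollifier n m x) ^ 2 ∂P : ℝ) : ℂ) := by
    simp_rw [h3]
    rw [integral_neg, h1]
    push_cast
    ring
  refine le_trans (le_of_eq (lintegral_congr fun k => ?_))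
    (lintegral_enorm_le_of_integral_le hint ?_ h4
      (hXG.integral_sq_le hψ.integrable (mollifier_nonneg n m) (integral_mollifier n m)))
  · rw [Pi.mul_apply, enorm_mul, enorm_mul, enorm_pow, enorm_pow, enorm_complex_ofReal,
      Real.enorm_eq_ofReal_abs, ← ENNReal.ofReal_pow (abs_nonneg _), sq_abs]
  · filter_upwards [h0] with k hk
    rw [fourier_mollifier_sq]
    refine mul_nonneg (mul_nonneg ?_ hk) (Complex.zero_le_real.2 (sq_nonneg _))
    exact_mod_cast sq_nonneg (2 * Real.pi * inner ℝ k w : ℝ)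

/-- Each direction of an orthonormal basis is bounded by the whole `e₀`, which accounts for the
factor `n`. -/
theorem lintegral_norm_sq_spectral_le (hY : IsRandomState P Y) {e₀ : ℝ≥0}
    (he : HasMeanEnergyDensity P Y e₀) {q : Fin 2 → Fin 2 → E n → ℝ} (hq : HasCovariance P Y q)
    {f : E n → ℂ} (hf : IsInvFourier (q 0 0) f) (h0 : ∀ᵐ k, 0 ≤ f k) :
    ∫⁻ k, ENNReal.ofReal ((2 * Real.pi * ‖k‖) ^ 2) * ‖f k‖ₑ ≤ n * e₀ := by
  set b := EuclideanSpace.basisFun (Fin n) ℝ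
  have h1 : ∀ k : E n, ENNReal.ofReal ((2 * Real.pi * ‖k‖) ^ 2) * ‖f k‖ₑ =
      ∑ l, ENNReal.ofReal ((2 * Real.pi * inner ℝ k (b l)) ^ 2) * ‖f k‖ₑ := by
    intro k
    rw [← Finset.sum_mul, ← ENNReal.ofReal_sum_of_nonneg fun l _ => sq_nonneg _]
    congr 2
    simp only [mul_pow]
    rw [← Finset.mul_sum, b.sum_sq_inner_left]
  simp_rw [h1]
  rw [lintegral_finsetSum' _ fun l _ => ?_]
  · refine (Finset.sum_le_sum fun l _ => lintegral_inner_sq_spectral_le hY he hq hf h0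
      (b.norm_eq_one l).le).trans ?_
    simp
  · exact (Measurable.aemeasurable (by fun_prop)).mul hf.1.1.enorm

end Moments

/-! ### The inverse second moment via cutoffs at all scales. -/

section InverseMoment

variable {n : ℕ}

/-- A smooth cutoff equal to `1` on the unit ball. -/
def cutoff (n : ℕ) : ContDiffBump (0 : E n) := ⟨1, 2, one_pos, one_lt_two⟩

theorem isTest_cutoff (n : ℕ) : IsTest (cutoff n) :=
  ⟨(cutoff n).contDiff, (cutoff n).hasCompactSupport⟩

theorem isTest_cutoff_smul (n : ℕ) {s : ℝ} (hs : 0 < s) : IsTest fun k : E n => cutoff n (s • k) :=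
  ⟨(isTest_cutoff n).1.comp (contDiff_const_smul s),
    (isTest_cutoff n).2.comp_homeomorph (Homeomorph.smulOfNeZero s hs.ne')⟩

theorem fourierInv_cutoff_smul {s : ℝ} (hs : 0 < s) (x : E n) :
    (𝓕⁻ (isTest_cutoff_smul n hs).toSchwartz) x =
      (((s ^ n)⁻¹ : ℝ) : ℂ) * (𝓕⁻ (isTest_cutoff n).toSchwartz) (s⁻¹ • x) := by
  rw [SchwartzMap.fourierInv_coe, SchwartzMap.fourierInv_coe, Real.fourierInv_eq',
    Real.fourierInv_eq']
  have h := Measure.integral_comp_smul (volume : Measure (E n)) (fun k => Complex.exp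
    (((2 * Real.pi * inner ℝ k (s⁻¹ • x) : ℝ) : ℂ) * Complex.I) • (isTest_cutoff n).toSchwartz k) s
  rw [finrank_euclideanSpace, Fintype.card_fin, abs_of_nonneg (by positivity), Complex.real_smul] at h
  rw [← h]
  refine integral_congr_ae (ae_of_all _ fun k => ?_)
  simp only [IsTest.toSchwartz_apply, inner_smul_left, inner_smul_right]
  congr 5
  simp only [conj_trivial]
  rw [inv_mul_cancel_left₀ hs.ne']

theorem two_mul_ofReal (a : ℝ) : 2 * ENNReal.ofReal a = ENNReal.ofReal (2 * a) := by
  rw [ENNReal.ofReal_mul zero_le_two, ENNReal.ofReal_ofNat]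

theorem lintegral_enorm_eq_enorm_integral {F : E n → ℂ} (hF : Integrable F)
    (h0 : ∀ᵐ k, 0 ≤ F k) : ∫⁻ k, ‖F k‖ₑ = ‖∫ k, F k‖ₑ := by
  have h1 : ((∫ k, ‖F k‖ : ℝ) : ℂ) = ∫ k, F k := by
    rw [← integral_complex_ofReal]
    refine integral_congr_ae ?_
    filter_upwards [h0] with k hk using Complex.norm_of_nonneg' hk
  rw [← ofReal_integral_norm_eq_lintegral_enorm hF, ← h1, enorm_complex_ofReal,
    Real.enorm_of_nonneg (integral_nonneg fun k => norm_nonneg _)]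

/-- Since `f ≥ 0`, its mass at frequencies of order `1 / s` is the modulus of a pairing, which
passes to `q` against a kernel dilated to scale `s`. -/
theorem lintegral_spectral_mul_cutoff_le {q : E n → ℝ} {f : E n → ℂ} (hf : IsInvFourier q f)
    (h0 : ∀ᵐ k, 0 ≤ f k) {s : ℝ} (hs : 0 < s) :
    ∫⁻ k, ‖f k‖ₑ * ENNReal.ofReal (cutoff n (s • k)) ≤
      ∫⁻ x, ‖q x‖ₑ * (ENNReal.ofReal (s ^ n)⁻¹ *
        ‖(𝓕⁻ (isTest_cutoff n).toSchwartz) (s⁻¹ • x)‖ₑ) := by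
  obtain ⟨η, hη, hFη⟩ : ∃ η : 𝓢(E n, ℂ), (∀ k, η k = (cutoff n (s • k) : ℂ)) ∧
      ∀ x, (𝓕⁻ η) x = (((s ^ n)⁻¹ : ℝ) : ℂ) * (𝓕⁻ (isTest_cutoff n).toSchwartz) (s⁻¹ • x) :=
    ⟨(isTest_cutoff_smul n hs).toSchwartz, fun k => rfl, fourierInv_cutoff_smul hs⟩
  have hint : Integrable (fun k => f k * η k) := hf.1.integrable_mul (η.memLp 2)
  have h1 := lintegral_enorm_eq_enorm_integral hint (by
    filter_upwards [h0] with k hk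
    rw [hη]
    exact mul_nonneg hk (Complex.zero_le_real.2 (cutoff n).nonneg))
  have hq : ‖∫ k, f k * η k‖ₑ ≤ ∫⁻ x, ‖(q x : ℂ) * (𝓕⁻ η) x‖ₑ := by
    rw [hf.2 η]
    exact enorm_integral_le_lintegral_enorm _
  have e1 : ∀ k, ‖f k * η k‖ₑ = ‖f k‖ₑ * ENNReal.ofReal (cutoff n (s • k)) := by
    intro k
    rw [enorm_mul, hη, enorm_complex_ofReal, Real.enorm_of_nonneg (cutoff n).nonneg]
  have e2 : ∀ x, ‖(q x : ℂ) * (𝓕⁻ η) x‖ₑ = ‖q x‖ₑ * (ENNReal.ofReal (s ^ n)⁻¹ *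
        ‖(𝓕⁻ (isTest_cutoff n).toSchwartz) (s⁻¹ • x)‖ₑ) := by
    intro x
    rw [enorm_mul, hFη, enorm_mul, enorm_complex_ofReal,
          enorm_complex_ofReal, Real.enorm_of_nonneg (inv_nonneg.2 (pow_nonneg hs.le n))]
  simp only [e1] at h1
  simp only [e2] at hq
  exact h1.trans_le hq

/-- The cutoff is `1` for `s ≤ 1 / ‖k‖`, and `s` integrates to half of `‖k‖⁻²` over that range. -/
theorem inv_sq_le_lintegral_cutoff {k : E n} (hk : k ≠ 0) :
    ENNReal.ofReal (‖k‖ ^ 2)⁻¹ ≤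
      2 * ∫⁻ s in Set.Ioi (0 : ℝ), ENNReal.ofReal s * ENNReal.ofReal (cutoff n (s • k)) := by
  have hk' : 0 < ‖k‖ := norm_pos_iff.2 hk
  have h1 : ∫⁻ s in Set.Ioc 0 ‖k‖⁻¹, ENNReal.ofReal s = ENNReal.ofReal ((‖k‖ ^ 2)⁻¹ / 2) := by
    rw [← ofReal_integral_eq_lintegral_ofReal]
    · rw [← intervalIntegral.integral_of_le (by positivity), integral_id]
      congr 1
      simp
    · exact continuous_id.integrableOn_Ioc
    · filter_upwards [ae_restrict_mem measurableSet_Ioc] with s hs using hs.1.le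
  calc ENNReal.ofReal (‖k‖ ^ 2)⁻¹ = 2 * ENNReal.ofReal ((‖k‖ ^ 2)⁻¹ / 2) := by
        rw [two_mul_ofReal]
        congr 1
        ring
    _ = 2 * ∫⁻ s in Set.Ioc 0 ‖k‖⁻¹, ENNReal.ofReal s * ENNReal.ofReal (cutoff n (s • k)) := by
        rw [← h1]
        congr 1
        refine setLIntegral_congr_fun measurableSet_Ioc fun s hs => ?_
        rw [(cutoff n).one_of_mem_closedBall]
        · simp
        · rw [mem_closedBall_zero_iff, norm_smul, Real.norm_of_nonneg hs.1.le]
          exact (mul_le_mul_of_nonneg_right hs.2 hk'.le).trans_eq (inv_mul_cancel₀ hk'.ne')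
    _ ≤ _ := by
        gcongr
        exact Set.Ioc_subset_Ioi_self

/-- Split at `s = ‖x‖`. Below, the decay of order `n` bounds the integrand by `C ‖x‖ ^ (1 - n)` on
an interval of length `‖x‖`; above, boundedness of `h` leaves `C s ^ (1 - n)`, integrable at
infinity because `n ≥ 3`. Each part contributes `C ‖x‖ ^ (2 - n)` at most. -/
theorem lintegral_scaled_le (hn : 3 ≤ n) {h : E n → ℂ} {C : ℝ} (hC : ∀ y, ‖h y‖ ≤ C)
    (hC' : ∀ y, ‖y‖ ^ n * ‖h y‖ ≤ C) {x : E n} (hx : x ≠ 0) :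
    ∫⁻ s in Set.Ioi (0 : ℝ), ENNReal.ofReal s * (ENNReal.ofReal (s ^ n)⁻¹ * ‖h (s⁻¹ • x)‖ₑ) ≤
      ENNReal.ofReal (2 * C * (‖x‖ ^ (n - 2))⁻¹) := by
  have hR : 0 < ‖x‖ := norm_pos_iff.2 hx
  set R := ‖x‖ with hRdef
  have hC0 : 0 ≤ C := (norm_nonneg _).trans (hC 0)
  have e : ∀ s : ℝ, 0 < s → ENNReal.ofReal s * (ENNReal.ofReal (s ^ n)⁻¹ * ‖h (s⁻¹ • x)‖ₑ) =
      ENNReal.ofReal (s * ((s ^ n)⁻¹ * ‖h (s⁻¹ • x)‖)) := by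
    intro s hs
    rw [ENNReal.ofReal_mul hs.le, ENNReal.ofReal_mul (by positivity), ofReal_norm]
  have h1 : ∫⁻ s in Set.Ioc 0 R,
      ENNReal.ofReal s * (ENNReal.ofReal (s ^ n)⁻¹ * ‖h (s⁻¹ • x)‖ₑ) ≤
      ENNReal.ofReal (C * (R ^ (n - 2))⁻¹) := by
    calc _ ≤ ∫⁻ s in Set.Ioc 0 R, ENNReal.ofReal (C * (R ^ n)⁻¹ * R) := by
          refine setLIntegral_mono measurable_const fun s hs => ?_
          rw [e s hs.1]
          refine ENNReal.ofReal_le_ofReal ?_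
          have h2 := hC' (s⁻¹ • x)
          have hs0 := hs.1
          rw [norm_smul, Real.norm_of_nonneg (by positivity), mul_pow, inv_pow, ← hRdef] at h2
          have h3 : (s ^ n)⁻¹ * ‖h (s⁻¹ • x)‖ ≤ C * (R ^ n)⁻¹ := by
            rw [← div_eq_mul_inv, le_div_iff₀ (by positivity)]
            linarith
          rw [mul_comm]
          exact mul_le_mul h3 hs.2 hs0.le (by positivity)
      _ = _ := by
          rw [setLIntegral_const, Real.volume_Ioc, ← ENNReal.ofReal_mul (by positivity)]
          congr 1
          obtain ⟨m, rfl⟩ : ∃ m, n = m + 2 := ⟨n - 2, by omega⟩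
          simp only [Nat.add_sub_cancel, sub_zero]
          field_simp
          ring
  have h2 : ∫⁻ s in Set.Ioi R,
      ENNReal.ofReal s * (ENNReal.ofReal (s ^ n)⁻¹ * ‖h (s⁻¹ • x)‖ₑ) ≤
      ENNReal.ofReal (C * (R ^ (n - 2))⁻¹) := by
    have hn' : (3 : ℝ) ≤ n := by exact_mod_cast hn
    have hlt : (1 - n : ℝ) < -1 := by linarith
    have hint := integrableOn_Ioi_rpow_of_lt hlt hR
    calc _ ≤ ∫⁻ s in Set.Ioi R, ENNReal.ofReal (C * s ^ (1 - n : ℝ)) := by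
          refine setLIntegral_mono (by fun_prop) fun s hs => ?_
          have hs0 : 0 < s := hR.trans hs
          rw [e s hs0]
          refine ENNReal.ofReal_le_ofReal ?_
          rw [Real.rpow_sub hs0, Real.rpow_one, Real.rpow_natCast, div_eq_mul_inv, ← mul_assoc,
            mul_comm C]
          exact mul_le_mul_of_nonneg_left (hC _) (by positivity)
      _ = ENNReal.ofReal (∫ s in Set.Ioi R, C * s ^ (1 - n : ℝ)) := by
          rw [ofReal_integral_eq_lintegral_ofReal (hint.const_mul C)]
          filter_upwards [ae_restrict_mem measurableSet_Ioi] with s hs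
          have hs0 : 0 < s := hR.trans hs
          simp only [Pi.zero_apply]
          positivity
      _ ≤ _ := by
          refine ENNReal.ofReal_le_ofReal ?_
          rw [integral_const_mul, integral_Ioi_rpow_of_lt hlt hR]
          have e1 : (1 - n + 1 : ℝ) = -((n - 2 : ℕ) : ℝ) := by
            rw [Nat.cast_sub (by omega)]
            push_cast
            ring
          have e2 : (1 : ℝ) ≤ ((n - 2 : ℕ) : ℝ) := by exact_mod_cast (by omega : 1 ≤ n - 2)
          rw [e1, Real.rpow_neg hR.le, Real.rpow_natCast, neg_div_neg_eq]
          gcongr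
          exact div_le_self (by positivity) e2
  rw [← Set.Ioc_union_Ioi_eq_Ioi hR.le]
  refine (lintegral_union_le _ _ _).trans ((add_le_add h1 h2).trans (le_of_eq ?_))
  rw [← ENNReal.ofReal_add (by positivity) (by positivity)]
  congr 1
  ring

/-- The Riesz potential of the covariance bounds the inverse second moment of the spectral
density. -/
theorem exists_lintegral_inv_sq_spectral_le (hn : 3 ≤ n) : ∃ C : ℝ, 0 ≤ C ∧
    ∀ (q : E n → ℝ) (f : E n → ℂ), AEStronglyMeasurable q volume → IsInvFourier q f →
      (∀ᵐ k, 0 ≤ f k) →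
      ∫⁻ k, ENNReal.ofReal (‖k‖ ^ 2)⁻¹ * ‖f k‖ₑ ≤
        ENNReal.ofReal C * ∫⁻ x, ‖q x‖ₑ * ENNReal.ofReal (‖x‖ ^ (n - 2))⁻¹ := by
  have : NeZero n := ⟨by omega⟩
  have hne : ∀ᵐ x : E n, x ≠ 0 := by
    simp [ae_iff]
  set h : 𝓢(E n, ℂ) := 𝓕⁻ (isTest_cutoff n).toSchwartz with hh
  obtain ⟨C₁, hC₁, hd₁⟩ := h.decay 0 0
  obtain ⟨C₂, hC₂, hd₂⟩ := h.decay n 0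
  simp only [pow_zero, one_mul, norm_iteratedFDeriv_zero] at hd₁ hd₂
  set C := max C₁ C₂
  have hC : 0 ≤ C := hC₁.le.trans (le_max_left _ _)
  -- One factor `2` comes from `inv_sq_le_lintegral_cutoff`, and `2 * C` from `lintegral_scaled_le`.
  refine ⟨4 * C, by positivity, fun q f hq hf h0 => ?_⟩
  have hm1 : AEMeasurable (fun z : E n × ℝ => ‖f z.1‖ₑ * (ENNReal.ofReal z.2 *
      ENNReal.ofReal (cutoff n (z.2 • z.1)))) (volume.prod (volume.restrict (Set.Ioi 0))) := by
    refine hf.1.1.enorm.comp_fst.mul (Measurable.aemeasurable ?_)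
    have : Measurable fun z : E n × ℝ => cutoff n (z.2 • z.1) :=
      ((cutoff n).continuous.comp (continuous_snd.smul continuous_fst)).measurable
    fun_prop
  have hm2 : AEMeasurable (fun z : ℝ × E n => ‖q z.2‖ₑ * (ENNReal.ofReal z.1 *
      (ENNReal.ofReal (z.1 ^ n)⁻¹ * ‖h (z.1⁻¹ • z.2)‖ₑ)))
      ((volume.restrict (Set.Ioi 0)).prod volume) := by
    have h1 : Measurable fun z : ℝ × E n => h (z.1⁻¹ • z.2) :=
      h.continuous.measurable.comp ((measurable_fst.inv).smul measurable_snd)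
    exact hq.enorm.comp_snd.mul (measurable_fst.ennreal_ofReal.mul
      ((measurable_fst.pow_const n).inv.ennreal_ofReal.mul h1.enorm)).aemeasurable
  calc ∫⁻ k, ENNReal.ofReal (‖k‖ ^ 2)⁻¹ * ‖f k‖ₑ
      ≤ ∫⁻ k, 2 * ∫⁻ s in Set.Ioi (0 : ℝ), ‖f k‖ₑ * (ENNReal.ofReal s *
          ENNReal.ofReal (cutoff n (s • k))) := by
        refine lintegral_mono_ae ?_
        filter_upwards [hne] with k hk
        rw [lintegral_const_mul' _ _ enorm_ne_top, mul_left_comm, mul_comm]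
        gcongr
        exact inv_sq_le_lintegral_cutoff hk
    _ = 2 * ∫⁻ s in Set.Ioi (0 : ℝ), ∫⁻ k, ‖f k‖ₑ * (ENNReal.ofReal s *
          ENNReal.ofReal (cutoff n (s • k))) := by
        rw [lintegral_const_mul' _ _ (by simp), lintegral_lintegral_swap hm1]
    _ ≤ 2 * ∫⁻ s in Set.Ioi (0 : ℝ), ∫⁻ x, ‖q x‖ₑ * (ENNReal.ofReal s *
          (ENNReal.ofReal (s ^ n)⁻¹ * ‖h (s⁻¹ • x)‖ₑ)) := by
        gcongr 2 * ?_
        refine setLIntegral_mono' measurableSet_Ioi fun s hs => ?_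
        simp only [mul_left_comm _ (ENNReal.ofReal s)]
        rw [lintegral_const_mul' _ _ ENNReal.ofReal_ne_top,
          lintegral_const_mul' _ _ ENNReal.ofReal_ne_top]
        gcongr 1
        exact lintegral_spectral_mul_cutoff_le hf h0 hs
    _ = 2 * ∫⁻ x, ‖q x‖ₑ * ∫⁻ s in Set.Ioi (0 : ℝ), (ENNReal.ofReal s *
          (ENNReal.ofReal (s ^ n)⁻¹ * ‖h (s⁻¹ • x)‖ₑ)) := by
        rw [lintegral_lintegral_swap hm2]
        simp_rw [lintegral_const_mul' _ _ enorm_ne_top]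
    _ ≤ 2 * ∫⁻ x, ENNReal.ofReal (2 * C) * (‖q x‖ₑ * ENNReal.ofReal (‖x‖ ^ (n - 2))⁻¹) := by
        gcongr 2 * ?_
        refine lintegral_mono_ae ?_
        filter_upwards [hne] with x hx
        rw [mul_left_comm, ← ENNReal.ofReal_mul (by positivity)]
        gcongr
        exact lintegral_scaled_le hn (fun y => (hd₁ y).trans (le_max_left _ _))
          (fun y => (hd₂ y).trans (le_max_right _ _)) hx
    _ = _ := by
        rw [lintegral_const_mul' _ _ ENNReal.ofReal_ne_top, ← mul_assoc, two_mul_ofReal]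
        congr 2
        ring

end InverseMoment

/-! ### Rescaling by `2π` and collection of the bounds. -/

section Assembly

variable {n : ℕ}

theorem two_pi_inv_ne_zero : (2 * Real.pi)⁻¹ ≠ 0 := inv_ne_zero Real.two_pi_pos.ne'

theorem abs_inv_pow_two_pi_inv (n : ℕ) :
    |(((2 * Real.pi)⁻¹ : ℝ) ^ n)⁻¹| = (2 * Real.pi) ^ n := by
  rw [inv_pow, inv_inv, abs_of_nonneg (pow_nonneg Real.two_pi_pos.le n)]

theorem memLp_comp_smul {f : E n → ℂ} {p : ℝ≥0∞} (hf : MemLp f p volume) {c : ℝ} (hc : c ≠ 0) :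
    MemLp (fun k => f (c • k)) p volume := by
  have h1 : MemLp f p (Measure.map (fun k : E n => c • k) volume) := by
    rw [Measure.map_addHaar_smul volume hc]
    exact hf.smul_measure ENNReal.ofReal_ne_top
  exact h1.comp_of_map (measurable_const_smul c).aemeasurable

/-- For `1 ≤ p ≤ 2` one has `t ^ p ≤ t + t ^ 2`. -/
theorem memLp_of_memLp_one_of_memLp_two {α F : Type*} [MeasurableSpace α] {μ : Measure α}
    [NormedAddCommGroup F] {f : α → F} (h1 : MemLp f 1 μ) (h2 : MemLp f 2 μ) {p : ℝ≥0∞}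
    (hp1 : 1 ≤ p) (hp2 : p ≤ 2) : MemLp f p μ := by
  have htop : p ≠ ∞ := (hp2.trans_lt ENNReal.ofNat_lt_top).ne
  have hp0 : p ≠ 0 := (zero_lt_one.trans_le hp1).ne'
  have hr1 : 1 ≤ p.toReal := by
    simpa using (ENNReal.toReal_le_toReal ENNReal.one_ne_top htop).2 hp1
  have hr2 : p.toReal ≤ 2 := by
    simpa using (ENNReal.toReal_le_toReal htop ENNReal.ofNat_ne_top).2 hp2
  refine ⟨h1.1, ?_⟩
  rw [eLpNorm_lt_top_iff_lintegral_rpow_enorm_lt_top hp0 htop]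
  have e1 := lintegral_rpow_enorm_lt_top_of_eLpNorm_lt_top one_ne_zero ENNReal.one_ne_top h1.2
  have e2 := lintegral_rpow_enorm_lt_top_of_eLpNorm_lt_top two_ne_zero ENNReal.ofNat_ne_top h2.2
  simp only [ENNReal.toReal_one, ENNReal.toReal_ofNat] at e1 e2
  calc ∫⁻ a, ‖f a‖ₑ ^ p.toReal ∂μ
      ≤ ∫⁻ a, (‖f a‖ₑ ^ (1 : ℝ) + ‖f a‖ₑ ^ (2 : ℝ)) ∂μ := by
        refine lintegral_mono fun a => ?_
        rcases le_total ‖f a‖ₑ 1 with h | h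
        · exact (ENNReal.rpow_le_rpow_of_exponent_ge h hr1).trans le_self_add
        · exact (ENNReal.rpow_le_rpow_of_exponent_le h hr2).trans le_add_self
    _ = (∫⁻ a, ‖f a‖ₑ ^ (1 : ℝ) ∂μ) + ∫⁻ a, ‖f a‖ₑ ^ (2 : ℝ) ∂μ :=
        lintegral_add_left' (h1.1.enorm.pow_const _) _
    _ < ∞ := ENNReal.add_lt_top.2 ⟨e1, e2⟩

theorem integral_comp_two_pi_inv_smul {F : Type*} [NormedAddCommGroup F] [NormedSpace ℝ F]
    (g : E n → F) :
    ∫ k, g ((2 * Real.pi)⁻¹ • k) = ((2 * Real.pi) ^ n : ℝ) • ∫ k, g k := by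
  have h := Measure.integral_comp_smul (volume : Measure (E n)) g (2 * Real.pi)⁻¹
  rwa [finrank_euclideanSpace, Fintype.card_fin, abs_inv_pow_two_pi_inv] at h

/-- Rescaling from Mathlib's normalization of the Fourier transform. -/
theorem isTemperedFourier_of_isInvFourier {q : E n → ℝ} (hq : MemLp q 2 volume) {f : E n → ℂ}
    (hf : IsInvFourier q f) : IsTemperedFourier q (fun k => f ((2 * Real.pi)⁻¹ • k)) := by
  refine ⟨fun ψ => hq.ofReal.integrable_mul (ψ.memLp 2),
    fun ψ => (memLp_comp_smul hf.1 two_pi_inv_ne_zero).integrable_mul (ψ.memLp 2), fun ψ => ?_⟩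
  -- `ψ'` is `ψ` dilated by `2π`. The Jacobian `(2π)^n` arises both from the pairing with `f` and
  -- from passing from `𝓕⁻ ψ'` to `fourier ψ`, so it cancels.
  set ψ' : 𝓢(E n, ℂ) := SchwartzMap.compCLMOfContinuousLinearEquiv ℂ
    (ContinuousLinearEquiv.smulLeft (Units.mk0 (2 * Real.pi) Real.two_pi_pos.ne')) ψ with hψ'
  have hval : ∀ k, ψ' ((2 * Real.pi)⁻¹ • k) = ψ k := by
    intro k
    change ψ ((2 * Real.pi) • ((2 * Real.pi)⁻¹ • k)) = ψ k
    rw [smul_smul, mul_inv_cancel₀ Real.two_pi_pos.ne', one_smul]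
  clear_value ψ'
  have h1 := integral_comp_two_pi_inv_smul (fun k => f k * ψ' k)
  simp only [hval] at h1
  rw [h1, hf.2, Complex.real_smul, ← integral_const_mul]
  refine integral_congr_ae (ae_of_all _ fun x => ?_)
  simp only
  rw [mul_left_comm]
  congr 1
  rw [SchwartzMap.fourierInv_coe, Real.fourierInv_eq', fourier, ← Complex.real_smul,
    ← integral_comp_two_pi_inv_smul]
  refine integral_congr_ae (ae_of_all _ fun k => ?_)
  simp only [hval, smul_eq_mul, inner_smul_left, conj_trivial]
  have h2 : 2 * Real.pi * ((2 * Real.pi)⁻¹ * inner ℝ k x) = inner ℝ x k := by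
    rw [mul_inv_cancel_left₀ Real.two_pi_pos.ne', real_inner_comm]
  rw [← h2, mul_comm Complex.I]

/-- The Riesz potential of the decay rate `√φ`. -/
def rieszPotential (n : ℕ) (φ : ℝ → ℝ) : ℝ :=
  ∫ x : E n, √(φ (‖x‖ / 2)) * (‖x‖ ^ (n - 2))⁻¹

theorem rieszPotential_nonneg (n : ℕ) (φ : ℝ → ℝ) : 0 ≤ rieszPotential n φ :=
  integral_nonneg fun x => by positivity

variable {Ω : Type*} [MeasurableSpace Ω] {P : Measure Ω} {Y : Fin 2 → Ω → E n → ℝ}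
  [IsProbabilityMeasure P]

theorem lintegral_cov_mul_le (hn : 3 ≤ n) (hY : IsRandomState P Y) {e₀ : ℝ≥0} (hz : ZeroMean P Y)
    (he : HasMeanEnergyDensity P Y e₀) {q : Fin 2 → Fin 2 → E n → ℝ} (hq : HasCovariance P Y q)
    (hmix : IsMixing P Y) (i j : Fin 2) :
    ∫⁻ x, ‖q i j x‖ₑ * ENNReal.ofReal (‖x‖ ^ (n - 2))⁻¹ ≤
      ENNReal.ofReal (2 * e₀ * rieszPotential n (mixingCoeff P Y)) := by
  have hint := integrable_sqrt_comp_norm_half_mul hn (mixingCoeff_antitone P Y)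
    (mixingCoeff_le_one P Y) hmix.2
  rw [rieszPotential, ← integral_const_mul, ofReal_integral_eq_lintegral_ofReal
    (hint.const_mul _) (ae_of_all _ fun x => by positivity)]
  refine lintegral_mono_ae ?_
  filter_upwards [ae_abs_cov_le_mixing (by omega) hY hz he hq i j] with x hx
  rw [← ofReal_norm, ← ENNReal.ofReal_mul (norm_nonneg _)]
  refine ENNReal.ofReal_le_ofReal ?_
  rw [← mul_assoc]
  exact mul_le_mul_of_nonneg_right hx (by positivity)

theorem norm_entry_le {A : Fin 2 → Fin 2 → ℂ}
    (h : ∀ w : ℝ, 2 * (w * ‖A 0 1‖) ≤ w ^ 2 * ‖A 0 0‖ + ‖A 1 1‖ ∧ ‖A 1 0‖ = ‖A 0 1‖) {w : ℝ}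
    (hw : 0 ≤ w) (i j : Fin 2) :
    w ^ (2 - (i : ℕ) - (j : ℕ)) * ‖A i j‖ ≤ w ^ 2 * ‖A 0 0‖ + ‖A 1 1‖ ∧
      ‖A i j‖ ≤ ‖A 0 0‖ + ‖A 1 1‖ := by
  have n0 := norm_nonneg (A 0 0)
  have n1 := norm_nonneg (A 1 1)
  have n2 := mul_nonneg hw (norm_nonneg (A 0 1))
  have n3 := norm_nonneg (A 0 1)
  have n4 := mul_nonneg (sq_nonneg w) n0
  obtain ⟨h1, h2⟩ := h w
  obtain ⟨h3, -⟩ := h 1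
  fin_cases i <;> fin_cases j <;> constructor <;> simp [h2] <;> linarith

/-- All entries reduce to the diagonal. The constant collects `n` from the gradient, `1` from the
mass of `f 1 1`, and `2 * C * R` from the inverse moment of each diagonal entry. -/
theorem memLp_spectral_and_moment (hn : 3 ≤ n) {C : ℝ} (hC0 : 0 ≤ C)
    (hC : ∀ (q : E n → ℝ) (f : E n → ℂ), AEStronglyMeasurable q volume → IsInvFourier q f →
      (∀ᵐ k, 0 ≤ f k) →
      ∫⁻ k, ENNReal.ofReal (‖k‖ ^ 2)⁻¹ * ‖f k‖ₑ ≤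
        ENNReal.ofReal C * ∫⁻ x, ‖q x‖ₑ * ENNReal.ofReal (‖x‖ ^ (n - 2))⁻¹)
    (hY : IsRandomState P Y) {e₀ : ℝ≥0} (hz : ZeroMean P Y)
    (he : HasMeanEnergyDensity P Y e₀) {q : Fin 2 → Fin 2 → E n → ℝ} (hq : HasCovariance P Y q)
    (hmix : IsMixing P Y) {f : Fin 2 → Fin 2 → E n → ℂ}
    (hf : ∀ i j, IsInvFourier (q i j) (f i j)) (i j : Fin 2) :
    MemLp (f i j) 1 volume ∧
    ∫⁻ k, ENNReal.ofReal (((2 * Real.pi * ‖k‖) ^ (2 - (i : ℕ) - (j : ℕ)) +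
        ((2 * Real.pi * ‖k‖) ^ 2)⁻¹) * ‖f i j k‖) ≤
      ENNReal.ofReal ((n + 1 + 4 * C * rieszPotential n (mixingCoeff P Y)) * e₀) := by
  have hX := hY.isField he
  have hpos := ae_spectral_nonneg hX hq hf
  have hd : ∀ i, ∀ᵐ k, 0 ≤ f i i k := fun i => by
    filter_upwards [hpos] with k hk using diag_nonneg_of_form_nonneg (A := fun i j => f i j k) hk i
  have hdom : ∀ᵐ k, ∀ w : ℝ, 0 ≤ w → ∀ i j : Fin 2,
      w ^ (2 - (i : ℕ) - (j : ℕ)) * ‖f i j k‖ ≤ w ^ 2 * ‖f 0 0 k‖ + ‖f 1 1 k‖ ∧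
      ‖f i j k‖ ≤ ‖f 0 0 k‖ + ‖f 1 1 k‖ := by
    filter_upwards [hpos] with k hk w hw i j
    exact norm_entry_le (A := fun i j => f i j k) (norm_offDiag_le_of_form_nonneg hk) hw i j
  have hmass : ∀ i, ∫⁻ k, ‖f i i k‖ₑ ≤ e₀ := fun i =>
    lintegral_spectral_le (hX i) (hq i i) (hf i i) (hd i)
  have hgrad := lintegral_norm_sq_spectral_le hY he hq (hf 0 0) (hd 0)
  set R := rieszPotential n (mixingCoeff P Y) with hR
  have hR0 : 0 ≤ R := rieszPotential_nonneg _ _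
  have hinv : ∀ i, ∫⁻ k, ENNReal.ofReal (‖k‖ ^ 2)⁻¹ * ‖f i i k‖ₑ ≤
      ENNReal.ofReal (2 * C * R * e₀) := fun i => by
    refine (hC _ _ ((hX i).aesm_cov (hX i) (hq i i)) (hf i i) (hd i)).trans ?_
    refine (mul_le_mul_right (lintegral_cov_mul_le hn hY hz he hq hmix i i) _).trans ?_
    rw [← ENNReal.ofReal_mul hC0]
    exact ENNReal.ofReal_le_ofReal (le_of_eq (by rw [← hR]; ring))
  have hfm : ∀ i, AEMeasurable (fun k => ‖f i i k‖ₑ) volume := fun i => (hf i i).1.1.enorm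
  constructor
  · refine ⟨(hf i j).1.1, ?_⟩
    rw [eLpNorm_one_eq_lintegral_enorm]
    calc ∫⁻ k, ‖f i j k‖ₑ ≤ ∫⁻ k, (‖f 0 0 k‖ₑ + ‖f 1 1 k‖ₑ) := by
          refine lintegral_mono_ae ?_
          filter_upwards [hdom] with k hk
          rw [← ofReal_norm, ← ofReal_norm, ← ofReal_norm,
            ← ENNReal.ofReal_add (norm_nonneg _) (norm_nonneg _)]
          exact ENNReal.ofReal_le_ofReal (hk 0 le_rfl i j).2
      _ = (∫⁻ k, ‖f 0 0 k‖ₑ) + ∫⁻ k, ‖f 1 1 k‖ₑ := lintegral_add_left' (hfm 0) _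
      _ < ∞ := ENNReal.add_lt_top.2 ⟨(hmass 0).trans_lt ENNReal.coe_lt_top,
          (hmass 1).trans_lt ENNReal.coe_lt_top⟩
  · have hm1 : AEMeasurable (fun k => ENNReal.ofReal ((2 * Real.pi * ‖k‖) ^ 2) * ‖f 0 0 k‖ₑ)
        volume := (Measurable.aemeasurable (by fun_prop)).mul (hfm 0)
    have hm2 : ∀ i, AEMeasurable (fun k => ENNReal.ofReal (‖k‖ ^ 2)⁻¹ * ‖f i i k‖ₑ)
        volume := fun i => (Measurable.aemeasurable (by fun_prop)).mul (hfm i)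
    have hm3 : AEMeasurable (fun k => ENNReal.ofReal ((2 * Real.pi * ‖k‖) ^ 2) * ‖f 0 0 k‖ₑ +
        ‖f 1 1 k‖ₑ) volume := hm1.add (hfm 1)
    calc _ ≤ ∫⁻ k, ((ENNReal.ofReal ((2 * Real.pi * ‖k‖) ^ 2) * ‖f 0 0 k‖ₑ + ‖f 1 1 k‖ₑ) +
          (ENNReal.ofReal (‖k‖ ^ 2)⁻¹ * ‖f 0 0 k‖ₑ + ENNReal.ofReal (‖k‖ ^ 2)⁻¹ * ‖f 1 1 k‖ₑ)) := by
          refine lintegral_mono_ae ?_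
          filter_upwards [hdom] with k hk
          obtain ⟨h1, h2⟩ := hk (2 * Real.pi * ‖k‖) (by positivity) i j
          rw [← ofReal_norm, ← ofReal_norm, ← ENNReal.ofReal_mul (by positivity),
            ← ENNReal.ofReal_mul (by positivity), ← ENNReal.ofReal_mul (by positivity),
            ← ENNReal.ofReal_add (by positivity) (by positivity),
            ← ENNReal.ofReal_add (by positivity) (by positivity),
            ← ENNReal.ofReal_add (by positivity) (by positivity)]
          refine ENNReal.ofReal_le_ofReal ?_
          rw [add_mul, ← mul_add]
          refine add_le_add h1 (mul_le_mul ?_ h2 (norm_nonneg _) (by positivity))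
          -- At `k = 0` both inverses take the default value `0`; elsewhere the factor `2π ≥ 1` only
          -- decreases the inverse.
          rcases (norm_nonneg k).eq_or_lt with h | h
          · simp [← h]
          · refine inv_anti₀ (by positivity) (pow_le_pow_left₀ h.le ?_ 2)
            exact le_mul_of_one_le_left h.le (by linarith [Real.pi_gt_three])
      _ = ((∫⁻ k, ENNReal.ofReal ((2 * Real.pi * ‖k‖) ^ 2) * ‖f 0 0 k‖ₑ) + ∫⁻ k, ‖f 1 1 k‖ₑ) +
          ((∫⁻ k, ENNReal.ofReal (‖k‖ ^ 2)⁻¹ * ‖f 0 0 k‖ₑ) +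
            ∫⁻ k, ENNReal.ofReal (‖k‖ ^ 2)⁻¹ * ‖f 1 1 k‖ₑ) := by
          rw [lintegral_add_left' hm3, lintegral_add_left' hm1,
            lintegral_add_left' (hm2 0)]
      _ ≤ ((n : ℝ≥0∞) * e₀ + e₀) + (ENNReal.ofReal (2 * C * R * e₀) +
          ENNReal.ofReal (2 * C * R * e₀)) :=
          add_le_add (add_le_add hgrad (hmass 1)) (add_le_add (hinv 0) (hinv 1))
      _ = _ := by
          have e1 : (e₀ : ℝ≥0∞) = ENNReal.ofReal e₀ := (ENNReal.ofReal_coe_nnreal).symm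
          rw [e1, ← ENNReal.ofReal_natCast, ← ENNReal.ofReal_mul (by positivity),
            ← ENNReal.ofReal_add (by positivity) (by positivity),
            ← ENNReal.ofReal_add (by positivity) (by positivity),
            ← ENNReal.ofReal_add (by positivity) (by positivity)]
          congr 1
          ring

end Assembly
end WaveCov

end

theorem proposition4p1 (n : ℕ) (hn : 3 ≤ n) :
    ∃ C : (ℝ → ℝ) → ℝ,
      ∀ (Ω : Type*) [MeasurableSpace Ω] (P : Measure Ω) [IsProbabilityMeasure P]
        (Y : Fin 2 → Ω → WaveCov.E n → ℝ) (q : Fin 2 → Fin 2 → WaveCov.E n → ℝ) (e₀ : ℝ≥0),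
        WaveCov.IsRandomState P Y →
        WaveCov.ZeroMean P Y →
        WaveCov.HasCovariance P Y q →
        WaveCov.HasMeanEnergyDensity P Y e₀ →
        WaveCov.IsMixing P Y →
        ∃ qhat : Fin 2 → Fin 2 → WaveCov.E n → ℂ,
          ∀ i j : Fin 2,
            WaveCov.IsTemperedFourier (q i j) (qhat i j) ∧
            (∀ p : ℝ≥0∞, 1 ≤ p → p ≤ 2 → MemLp (qhat i j) p volume) ∧
            Integrable (fun k : WaveCov.E n =>
              (‖k‖ ^ (2 - (i : ℕ) - (j : ℕ)) + (‖k‖ ^ 2)⁻¹) * ‖qhat i j k‖) ∧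
            ∫ k : WaveCov.E n,
              (‖k‖ ^ (2 - (i : ℕ) - (j : ℕ)) + (‖k‖ ^ 2)⁻¹) * ‖qhat i j k‖
                ≤ C (WaveCov.mixingCoeff P Y) * (e₀ : ℝ) := by
  obtain ⟨C, hC0, hC⟩ := WaveCov.exists_lintegral_inv_sq_spectral_le hn
  -- The factor `(2π)^n` is the Jacobian of the dilation from `f` to `qhat`.
  refine ⟨fun φ => (2 * Real.pi) ^ n * (n + 1 + 4 * C * WaveCov.rieszPotential n φ), ?_⟩
  intro Ω _ P _ Y q e₀ hY hz hq he hmix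
  have hL2 := WaveCov.memLp_two_cov hn hY hz he hq hmix
  choose f hf using fun i j => WaveCov.exists_isInvFourier (hL2 i j)
  refine ⟨fun i j k => f i j ((2 * Real.pi)⁻¹ • k), fun i j => ?_⟩
  obtain ⟨h1, hmom⟩ := WaveCov.memLp_spectral_and_moment hn hC0 hC hY hz he hq hmix hf i j
  set V : WaveCov.E n → ℝ := fun k => ((2 * Real.pi * ‖k‖) ^ (2 - (i : ℕ) - (j : ℕ)) +
        ((2 * Real.pi * ‖k‖) ^ 2)⁻¹) * ‖f i j k‖ with hV
  have hV0 : ∀ k, 0 ≤ V k := fun k => by positivity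
  have hVm : AEStronglyMeasurable V volume :=
    AEStronglyMeasurable.mul (Measurable.aestronglyMeasurable (by fun_prop)) h1.1.norm
  have hVi : Integrable V := by
    refine ⟨hVm, ?_⟩
    rw [hasFiniteIntegral_iff_ofReal (ae_of_all _ hV0)]
    exact hmom.trans_lt ENNReal.ofReal_lt_top
  have hVint : ∫ k, V k ≤
      (n + 1 + 4 * C * WaveCov.rieszPotential n (WaveCov.mixingCoeff P Y)) * e₀ := by
    have hR := WaveCov.rieszPotential_nonneg n (WaveCov.mixingCoeff P Y)
    rw [integral_eq_lintegral_of_nonneg_ae (ae_of_all _ hV0) hVm]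
    exact ENNReal.toReal_le_of_le_ofReal (by positivity) hmom
  have hW : ∀ k : WaveCov.E n, (‖k‖ ^ (2 - (i : ℕ) - (j : ℕ)) + (‖k‖ ^ 2)⁻¹) *
      ‖f i j ((2 * Real.pi)⁻¹ • k)‖ = V ((2 * Real.pi)⁻¹ • k) := by
    intro k
    have : 2 * Real.pi * ‖(2 * Real.pi)⁻¹ • k‖ = ‖k‖ := by
      rw [norm_smul, Real.norm_of_nonneg (inv_nonneg.2 Real.two_pi_pos.le),
        mul_inv_cancel_left₀ Real.two_pi_pos.ne']
    simp only [hV, this]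
  refine ⟨WaveCov.isTemperedFourier_of_isInvFourier (hL2 i j) (hf i j), fun p hp1 hp2 =>
    WaveCov.memLp_comp_smul (WaveCov.memLp_of_memLp_one_of_memLp_two h1 (hf i j).1 hp1 hp2)
      WaveCov.two_pi_inv_ne_zero, ?_, ?_⟩
  · simp only [hW]
    exact hVi.comp_smul WaveCov.two_pi_inv_ne_zero
  · simp only [hW]
    rw [WaveCov.integral_comp_two_pi_inv_smul, smul_eq_mul, mul_assoc]
    exact mul_le_mul_of_nonneg_left hVint (pow_nonneg Real.two_pi_pos.le n)
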